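/- Let $k$ be a field of characteristic zero, $n\ge 3$, $k[\mathbf x]=k[x_1,\dots,x_n]$, let $\Gamma$ be a finitely generated totally ordered abelian group and $\mathbf w=(w_1,\dots,w_n)\in\Gamma^n$ with all $w_i>0$. For $f\in k[\mathbf x]\setminus\{0\}$ let $\deg f=\deg_{\mathbf w}f$ be the largest weight $\sum_i a_iw_i$ of a monomial $x_1^{a_1}\cdots x_n^{a_n}$ occurring in $f$, let $f^{\mathbf w}$ be the weighted homogeneous component of $f$ of weight $\deg f$, and put $\deg 0=-\infty$. For a $k$-subspace $V\subseteq k[\mathbf x]$ let $V^{\mathbf w}$ be the $k$-span of $\{f^{\mathbf w}: f\in V\setminus\{0\}\}$. For a differential form $\omega=\sum_{i_1<\dots<i_l}f_{i_1,\dots,i_l}\,dx_{i_1}\wedge\dots\wedge dx_{i_l}$ of $k[\mathbf x]$ over $k$ put $\deg\omega=\max\deg(f_{i_1,\dots,i_l}x_{i_1}\cdots x_{i_l})$. Write $h_1\approx h_2$ if $h_1,h_2$ are linearly dependent over $k$. Let $F=(f_1,f_2,f_3)$ and $G=(g_1,g_2,g_3)$ be triples of elements of $k[\mathbf x]$, each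 algebraically independent over $k$, and let $S_i=\{f_1,f_2,f_3\}\setminus\{f_i\}$. The pair $(F,G)$ satisfies the *Shestakov-Umirbaev (SU) condition* if 1. $g_1=f_1+af_3^2+cf_3$ and $g_2=f_2+bf_3$ for some $a,b,c\in k$, and $g_3-f_3\in k[g_1,g_2]$; 2. $\deg f_1\le\deg g_1$ and $\deg f_2=\deg g_2$; 3. $(g_1^{\mathbf w})^2\approx(g_2^{\mathbf w})^s$ for some odd number $s\ge3$; 4. $\deg f_3\le\deg g_1$ and $f_3^{\mathbf w}\notin k[g_1^{\mathbf w},g_2^{\mathbf w}]$; 5. $\deg g_3<\deg f_3$; 6. $\deg g_3<\deg g_1-\deg g_2+\deg(dg_1\wedge dg_2)$. The triple $F$ *admits an elementary reduction* if $\sum_i\deg (F\circ E)(y_i)<\sum_i\deg f_i$ for some elementary automorphism $E$ of $k[y_1,y_2,y_3]$, that is, one with $E(y_l)=y_l+\phi$ and $E(y_i)=y_i$ for $i\ne l$, for some $l$ and some polynomial $\phi$ in the variables other than $y_l$; here $F$ is identified with the homomorphism $k[y_1,y_2,y_3]\to k[\mathbf x]$, $y_i\mapsto f_i$. Suppose that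 $(F,G)$ satisfies the SU condition. Then: - if $f_1^{\mathbf w}\not\approx(f_3^{\mathbf w})^2$, then $f_1^{\mathbf w}\notin k[S_1]^{\mathbf w}$; - $f_2^{\mathbf w}\notin k[S_2]^{\mathbf w}$; - if $(f_1,f_2)\ne(g_1,g_2)$, then $f_3^{\mathbf w}\notin k[S_3]^{\mathbf w}$. In particular, if $F$ also admits an elementary reduction, then $f_1^{\mathbf w}\approx(f_3^{\mathbf w})^2$ or $(f_1,f_2)=(g_1,g_2)$. -/

import Mathlib

namespace ShestakovUmirbaev

open MvPolynomial

noncomputable section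

variable {k : Type*} [Field k] {Γ : Type*} [AddCommGroup Γ] [LinearOrder Γ] {n : ℕ}

/-- The `w`-degree of a polynomial: the largest weight of a monomial occurring in `f`,
and `⊥` (that is, `-∞`) for `f = 0`. -/
def wdeg (w : Fin n → Γ) (f : MvPolynomial (Fin n) k) : WithBot Γ :=
  weightedTotalDegree' w f

/-- The `w`-initial form `f^w`: the weighted homogeneous component of `f` whose weight is the
`w`-degree of `f` (and `0` for `f = 0`). -/
def initialForm (w : Fin n → Γ) (f : MvPolynomial (Fin n) k) : MvPolynomial (Fin n) k :=
  weightedHomogeneousComponent w ((wdeg w f).unbotD 0) f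

/-- `V^w`: the `k`-subspace spanned by the initial forms of the nonzero elements of `V`. -/
def initialSpace (w : Fin n → Γ) (V : Submodule k (MvPolynomial (Fin n) k)) :
    Submodule k (MvPolynomial (Fin n) k) :=
  Submodule.span k {p | ∃ f ∈ V, f ≠ 0 ∧ p = initialForm w f}

/-- The `w`-degree of a differential `l`-form `ω = ∑_I f_I dx_I`, where `I` runs through the
`l`-element subsets of the index set: the maximum of the `w`-degrees of `f_I * ∏_{i ∈ I} x_i`. -/
def formDeg (w : Fin n → Γ) {l : ℕ}
    (ω : ⋀[MvPolynomial (Fin n) k]^l (Ω[MvPolynomial (Fin n) k⁄k])) : WithBot Γ :=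
  Finset.univ.sup fun I : Set.powersetCard (Fin n) l =>
    wdeg w ((((KaehlerDifferential.mvPolynomialBasis k (Fin n)).exteriorPower l).repr ω I) *
      ∏ i ∈ (I : Finset (Fin n)), X i)

/-- The differential `2`-form `df ∧ dg`. -/
def dWedge (f g : MvPolynomial (Fin n) k) :
    ⋀[MvPolynomial (Fin n) k]^2 (Ω[MvPolynomial (Fin n) k⁄k]) :=
  exteriorPower.ιMulti (MvPolynomial (Fin n) k) 2
    ![KaehlerDifferential.D k (MvPolynomial (Fin n) k) f,
      KaehlerDifferential.D k (MvPolynomial (Fin n) k) g]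

/-- `h₁ ≈ h₂`: the polynomials `h₁` and `h₂` are linearly dependent over `k`. -/
def Approx (h₁ h₂ : MvPolynomial (Fin n) k) : Prop :=
  ¬ LinearIndependent k ![h₁, h₂]

/-- `k[S_i]`, where `S_i = {f₁, f₂, f₃} \ {f_i}`. -/
def omitAlgebra (F : Fin 3 → MvPolynomial (Fin n) k) (i : Fin 3) :
    Subalgebra k (MvPolynomial (Fin n) k) :=
  Algebra.adjoin k (Set.range F \ {F i})

/-- The pair `(F, G)` satisfies the Shestakov-Umirbaev condition for the weight `w`.
The triples `(f₁, f₂, f₃)` and `(g₁, g₂, g₃)` are indexed by `Fin 3`, so that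
`f₁ = F 0`, `f₂ = F 1`, `f₃ = F 2`, and likewise for `G`. -/
structure SUCondition (w : Fin n → Γ) (F G : Fin 3 → MvPolynomial (Fin n) k) : Prop where
  su1 : (∃ a b c : k, G 0 = F 0 + C a * F 2 ^ 2 + C c * F 2 ∧ G 1 = F 1 + C b * F 2) ∧
    G 2 - F 2 ∈ Algebra.adjoin k {G 0, G 1}
  su2 : wdeg w (F 0) ≤ wdeg w (G 0) ∧ wdeg w (F 1) = wdeg w (G 1)
  su3 : ∃ s : ℕ, Odd s ∧ 3 ≤ s ∧
    Approx (initialForm w (G 0) ^ 2) (initialForm w (G 1) ^ s)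
  su4 : wdeg w (F 2) ≤ wdeg w (G 0) ∧
    initialForm w (F 2) ∉ Algebra.adjoin k {initialForm w (G 0), initialForm w (G 1)}
  su5 : wdeg w (G 2) < wdeg w (F 2)
  /-- `deg g₃ < deg g₁ - deg g₂ + deg (dg₁ ∧ dg₂)`, with `deg g₂` moved to the other side
  (it is finite whenever `g₂ ≠ 0`). -/
  su6 : wdeg w (G 2) + wdeg w (G 1) < wdeg w (G 0) + formDeg w (dWedge (G 0) (G 1))

/-- `E` is an elementary automorphism of `k[y₁, y₂, y₃]`: for some `l` it sends `y_l` to `y_l + φ`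
with `φ` a polynomial in the other two variables, and it fixes the other two variables. -/
def IsElementary (E : MvPolynomial (Fin 3) k →ₐ[k] MvPolynomial (Fin 3) k) : Prop :=
  ∃ l : Fin 3, ∃ φ ∈ Algebra.adjoin k {p : MvPolynomial (Fin 3) k | ∃ j, j ≠ l ∧ p = X j},
    E (X l) = X l + φ ∧ ∀ i, i ≠ l → E (X i) = X i

/-- `F` admits an elementary reduction for the weight `w`: the triple `F ∘ E` has smaller
`w`-degree than `F` for some elementary automorphism `E`. Here `F` is identified with the
homomorphism `k[y₁, y₂, y₃] → k[x]` sending `y_i` to `f_i`, and the degree of a triple is the sum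
of the degrees of its entries. -/
def AdmitsElementaryReduction (w : Fin n → Γ) (F : Fin 3 → MvPolynomial (Fin n) k) : Prop :=
  ∃ E : MvPolynomial (Fin 3) k →ₐ[k] MvPolynomial (Fin 3) k, IsElementary E ∧
    ∑ i, wdeg w (((aeval F).comp E) (X i)) < ∑ i, wdeg w (F i)

end

end ShestakovUmirbaev

open ShestakovUmirbaev

namespace ShestakovUmirbaev

open MvPolynomial
open Finsupp (weight weight_apply weight_single)

/-! ### Degrees and top homogeneous parts; a top part may be zero, so cancellation is allowed. -/

section Degree

variable {k : Type*} [Field k] {Γ : Type*} [AddCommGroup Γ] [LinearOrder Γ] {n : ℕ}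
  {w : Fin n → Γ} {f g u v : MvPolynomial (Fin n) k} {d e : Γ}

/-! The engine is a Shestakov-Umirbaev type inequality (`exists_dropBound`). Let `h = P(f, g)` with
`h^w` outside `k[f^w, g^w]`. Then the top form of `P` vanishes at `(f^w, g^w)`, which forces
`(f^w)^p` to be proportional to `(g^w)^q`, and some derivative of order `N + 1` of that top form in
the first variable does not vanish there, with `d ≥ (N + 1) p deg f` for the formal degree `d` of
`P` (`exists_order_of_vanishing`). Since `dP(f, g) ∧ dg = P_f(f, g) df ∧ dg`, each derivative costs
at most `deg f` in formal degree but gains control through `D = deg (df ∧ dg)`; the outcome is `deg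
h ≥ (N + 1) s` with `s = p deg f + D - deg f - deg g`, and information on `deg (dh ∧ dg)`.

Applied to `f₃ - g₃ ∈ k[g₁, g₂]`, whose initial form is that of `f₃`, this gives the numerical data
of `SUData`. Write `deg g₂ = 2δ` and `α = deg g₁`, an odd multiple of `δ`, at least `3δ`. By parity
the exponent of `g₁^w` is at least 2, so `f₃`, `df₃ ∧ df₂` and `df₃ ∧ df₁` have large degrees. If
`a` or `b` is nonzero, then `α = 3δ`.

Suppose `f_i^w ∈ k[S_i]^w`, so that `f_i^w = h^w` for some `h ∈ k[S_i]`. If `h^w` lies in the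
algebra of the two initial forms, comparing degrees leaves only proportionalities that contradict
`f₃^w ∉ k[g₁^w, g₂^w]`, or the excepted `f₁^w ≈ (f₃^w)²`. Otherwise the inequality applies again, to
the pair `S_i`, and contradicts the lower bounds for the 2-forms, again up to excluded
proportionalities. For `i = 3` this needs `deg (df₁ ∧ df₂)`, found from its expansion in the other
wedges (`dWedge_zero_one`). An elementary reduction puts some `f_i^w` in `k[S_i]^w`, hence the last
claim. -/

theorem wdeg_le_iff : wdeg w f ≤ d ↔ ∀ m ∈ f.support, weight w m ≤ d := by
  simp [wdeg, weightedTotalDegree', Finset.sup_le_iff, WithBot.coe_le_coe]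

theorem wdeg_lt_iff : wdeg w f < d ↔ ∀ m ∈ f.support, weight w m < d := by
  rw [wdeg, weightedTotalDegree', Finset.sup_lt_iff (WithBot.bot_lt_coe d)]
  simp [WithBot.coe_lt_coe]

theorem wdeg_eq_bot_iff : wdeg w f = ⊥ ↔ f = 0 := weightedTotalDegree'_eq_bot_iff w f

@[simp]
theorem wdeg_zero : wdeg w (0 : MvPolynomial (Fin n) k) = ⊥ := wdeg_eq_bot_iff.2 rfl

theorem exists_wdeg_eq_coe (hf : f ≠ 0) : ∃ d : Γ, wdeg w f = d :=
  WithBot.ne_bot_iff_exists.1 (mt wdeg_eq_bot_iff.1 hf) |>.imp fun _ h => h.symm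

theorem wdeg_add_le : wdeg w (f + g) ≤ max (wdeg w f) (wdeg w g) := by
  classical
  exact (Finset.sup_mono support_add).trans_eq Finset.sup_union

@[simp]
theorem wdeg_neg : wdeg w (-f) = wdeg w f := by
  simp [wdeg, weightedTotalDegree']

theorem wdeg_add_lt (hf : wdeg w f < d) (hg : wdeg w g < d) : wdeg w (f + g) < d :=
  wdeg_add_le.trans_lt (max_lt hf hg)

theorem wdeg_sum_lt {ι : Type*} (s : Finset ι) (F : ι → MvPolynomial (Fin n) k)
    (h : ∀ i ∈ s, wdeg w (F i) < d) : wdeg w (∑ i ∈ s, F i) < d := by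
  classical
  induction s using Finset.induction_on with
  | empty => simp
  | insert a s ha ih =>
    rw [Finset.sum_insert ha]
    exact wdeg_add_lt (h _ (by simp)) (ih fun i hi => h i (by simp [hi]))

theorem wdeg_le_of_homogeneous (hu : IsWeightedHomogeneous w u d) : wdeg w u ≤ d :=
  wdeg_le_iff.2 fun _ hm => (hu (mem_support_iff.1 hm)).le

theorem wdeg_of_homogeneous (hu : IsWeightedHomogeneous w u d) (h0 : u ≠ 0) : wdeg w u = d := by
  obtain ⟨m, hm⟩ := support_nonempty.2 h0
  refine le_antisymm (wdeg_le_of_homogeneous hu) ?_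
  rw [← hu (mem_support_iff.1 hm)]
  exact Finset.le_sup (f := fun m => ((weight w m : Γ) : WithBot Γ)) hm

theorem eq_zero_of_homogeneous_of_wdeg_lt (hu : IsWeightedHomogeneous w u d)
    (h : wdeg w u < d) : u = 0 := by
  by_contra h0
  exact h.ne (wdeg_of_homogeneous hu h0)

/-- `u` is the homogeneous component of weight `d` of `f`, and `f` has no component of
larger weight. -/
def HasTop (w : Fin n → Γ) (f : MvPolynomial (Fin n) k) (d : Γ)
    (u : MvPolynomial (Fin n) k) : Prop :=
  IsWeightedHomogeneous w u d ∧ wdeg w (f - u) < d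

namespace HasTop

theorem wdeg_le (h : HasTop w f d u) : wdeg w f ≤ d := by
  rw [← sub_add_cancel f u]
  exact wdeg_add_le.trans (max_le h.2.le (wdeg_le_of_homogeneous h.1))

theorem eq (h : HasTop w f d u) (h' : HasTop w f d v) : u = v := by
  refine sub_eq_zero.1 (eq_zero_of_homogeneous_of_wdeg_lt (h.1.sub h'.1) ?_)
  rw [show u - v = (f - v) + -(f - u) by ring]
  exact wdeg_add_lt h'.2 (wdeg_neg.trans_lt h.2)

theorem wdeg_eq (h : HasTop w f d u) (hu : u ≠ 0) : wdeg w f = d := by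
  refine le_antisymm h.wdeg_le (not_lt.1 fun hlt => hu ?_)
  exact h.eq ⟨isWeightedHomogeneous_zero _ _ _, by simpa using hlt⟩

theorem wdeg_lt (h : HasTop w f d 0) : wdeg w f < d := by simpa using h.2

theorem zero_of_lt (h : wdeg w f < d) : HasTop w f d 0 :=
  ⟨isWeightedHomogeneous_zero _ _ _, by simpa using h⟩

theorem of_homogeneous (h : IsWeightedHomogeneous w u d) : HasTop w u d u :=
  ⟨h, by simp⟩

theorem const (c : k) : HasTop w (C c) 0 (C c) := of_homogeneous (isWeightedHomogeneous_C w c)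

theorem add (hf : HasTop w f d u) (hg : HasTop w g d v) : HasTop w (f + g) d (u + v) :=
  ⟨hf.1.add hg.1, by
    rw [show f + g - (u + v) = (f - u) + (g - v) by ring]
    exact wdeg_add_lt hf.2 hg.2⟩

theorem neg (hf : HasTop w f d u) : HasTop w (-f) d (-u) :=
  ⟨hf.1.neg, by
    rw [show -f - -u = -(f - u) by ring, wdeg_neg]
    exact hf.2⟩

theorem sub (hf : HasTop w f d u) (hg : HasTop w g d v) : HasTop w (f - g) d (u - v) := by
  simpa [sub_eq_add_neg] using hf.add hg.neg

theorem sum {ι : Type*} (s : Finset ι) {F U : ι → MvPolynomial (Fin n) k}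
    (h : ∀ i ∈ s, HasTop w (F i) d (U i)) : HasTop w (∑ i ∈ s, F i) d (∑ i ∈ s, U i) :=
  ⟨IsWeightedHomogeneous.sum s U d fun i hi => (h i hi).1, by
    rw [← Finset.sum_sub_distrib]
    exact wdeg_sum_lt s _ fun i hi => (h i hi).2⟩

end HasTop

theorem hasTop_initialForm (h : wdeg w f = d) : HasTop w f d (initialForm w f) := by
  classical
  have hi : initialForm w f = weightedHomogeneousComponent w d f := by simp [initialForm, h]
  refine ⟨hi ▸ weightedHomogeneousComponent_isWeightedHomogeneous _ _, wdeg_lt_iff.2 ?_⟩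
  intro m hm
  rw [mem_support_iff, coeff_sub, hi, coeff_weightedHomogeneousComponent] at hm
  split_ifs at hm with hmd
  · simp at hm
  · exact lt_of_le_of_ne (wdeg_le_iff.1 h.le m (mem_support_iff.2 (by simpa using hm))) hmd

theorem initialForm_ne_zero (hf : f ≠ 0) : initialForm w f ≠ 0 := by
  obtain ⟨d, hd⟩ := exists_wdeg_eq_coe (w := w) hf
  intro h0
  have h := hasTop_initialForm hd
  rw [h0] at h
  exact h.wdeg_lt.ne hd

theorem HasTop.initialForm_eq (h : HasTop w f d u) (hu : u ≠ 0) : initialForm w f = u :=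
  (hasTop_initialForm (h.wdeg_eq hu)).eq h

end Degree

/-! ### Compatibility of top parts with products, substitution and derivatives. -/

section Ordered

variable {k : Type*} [Field k] {Γ : Type*} [AddCommGroup Γ] [LinearOrder Γ]
  [IsOrderedAddMonoid Γ] {n : ℕ}
  {w : Fin n → Γ} {f g u v : MvPolynomial (Fin n) k} {d e : Γ}

theorem wdeg_mul_lt (hf : wdeg w f < d) (hg : wdeg w g ≤ e) : wdeg w (f * g) < (d + e : Γ) := by
  classical
  refine wdeg_lt_iff.2 fun m hm => ?_
  obtain ⟨a, ha, b, hb, rfl⟩ := Finset.mem_add.1 (support_mul f g hm)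
  rw [map_add]
  exact add_lt_add_of_lt_of_le (wdeg_lt_iff.1 hf a ha) (wdeg_le_iff.1 hg b hb)

namespace HasTop

theorem mul (hf : HasTop w f d u) (hg : HasTop w g e v) : HasTop w (f * g) (d + e) (u * v) :=
  ⟨hf.1.mul hg.1, by
    rw [show f * g - u * v = (f - u) * g + (g - v) * u by ring]
    refine wdeg_add_lt (wdeg_mul_lt hf.2 hg.wdeg_le) ?_
    rw [add_comm d e]
    exact wdeg_mul_lt hg.2 (wdeg_le_of_homogeneous hf.1)⟩

theorem C_mul (hf : HasTop w f d u) (c : k) : HasTop w (C c * f) d (C c * u) := by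
  simpa using (const c).mul hf

theorem pow (hf : HasTop w f d u) (i : ℕ) : HasTop w (f ^ i) (i • d) (u ^ i) := by
  induction i with
  | zero => simpa using const (w := w) (1 : k)
  | succ i ih => rw [pow_succ, pow_succ, succ_nsmul]; exact ih.mul hf

theorem prod {ι : Type*} (s : Finset ι) {F U : ι → MvPolynomial (Fin n) k} {D : ι → Γ}
    (h : ∀ i ∈ s, HasTop w (F i) (D i) (U i)) :
    HasTop w (∏ i ∈ s, F i) (∑ i ∈ s, D i) (∏ i ∈ s, U i) := by
  classical
  induction s using Finset.induction_on with
  | empty => simpa using const (w := w) (1 : k)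
  | insert a s ha ih =>
    rw [Finset.prod_insert ha, Finset.prod_insert ha, Finset.sum_insert ha]
    exact (h _ (by simp)).mul (ih fun i hi => h i (by simp [hi]))

variable {r : ℕ} {W : Fin r → Γ} {F U : Fin r → MvPolynomial (Fin n) k}
  {P Q : MvPolynomial (Fin r) k}

theorem aeval_monomial (h : ∀ i, HasTop w (F i) (W i) (U i)) (m : Fin r →₀ ℕ) (c : k) :
    HasTop w (aeval F (monomial m c)) (weight W m) (aeval U (monomial m c)) := by
  simp only [MvPolynomial.aeval_monomial, algebraMap_eq]
  rw [Finsupp.prod_fintype _ _ (by simp), Finsupp.prod_fintype _ _ (by simp)]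
  have hw : weight W m = ∑ i, m i • W i := by
    rw [weight_apply, Finsupp.sum_fintype _ _ (by simp)]
  rw [hw]
  exact (prod Finset.univ fun i _ => (h i).pow (m i)).C_mul c

theorem wdeg_aeval_lt (h : ∀ i, HasTop w (F i) (W i) (U i)) (hP : wdeg W P < d) :
    wdeg w (aeval F P) < d := by
  rw [P.as_sum, map_sum]
  refine wdeg_sum_lt _ _ fun m hm => ?_
  exact (aeval_monomial h m _).wdeg_le.trans_lt (WithBot.coe_lt_coe.2 (wdeg_lt_iff.1 hP m hm))

/-- Evaluating a polynomial at `F` and taking top forms commute. -/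
protected theorem aeval (h : ∀ i, HasTop w (F i) (W i) (U i)) (hP : HasTop W P d Q) :
    HasTop w (aeval F P) d (aeval U Q) := by
  have h1 : HasTop w (MvPolynomial.aeval F Q) d (MvPolynomial.aeval U Q) := by
    rw [Q.as_sum, map_sum, map_sum]
    refine sum _ fun m hm => ?_
    rw [← hP.1 (mem_support_iff.1 hm)]
    exact aeval_monomial h m _
  have h2 := (zero_of_lt (wdeg_aeval_lt h hP.2)).add h1
  simpa using h2

theorem pderiv (l : Fin r) (hP : HasTop W P d Q) :
    HasTop W (pderiv l P) (d - W l) (pderiv l Q) := by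
  classical
  refine ⟨hP.1.pderiv (sub_add_cancel d (W l)), ?_⟩
  rw [← map_sub]
  refine wdeg_lt_iff.2 fun m hm => ?_
  rw [mem_support_iff, coeff_pderiv] at hm
  have h := wdeg_lt_iff.1 hP.2 _ (mem_support_iff.2 (left_ne_zero_of_mul hm))
  rw [map_add, weight_single, one_smul] at h
  exact lt_sub_iff_add_lt.2 h

theorem iterate_pderiv (l : Fin r) (hP : HasTop W P d Q) (m : ℕ) :
    HasTop W ((MvPolynomial.pderiv l)^[m] P) (d - m • W l) ((MvPolynomial.pderiv l)^[m] Q) := by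
  induction m with
  | zero => simpa using hP
  | succ m ih =>
    rw [Function.iterate_succ_apply', Function.iterate_succ_apply', succ_nsmul, ← sub_sub]
    exact ih.pderiv l

end HasTop

theorem wdeg_mul : wdeg w (f * g) = wdeg w f + wdeg w g := by
  by_cases hf : f = 0
  · simp [hf]
  by_cases hg : g = 0
  · simp [hg]
  obtain ⟨d, hd⟩ := exists_wdeg_eq_coe (w := w) hf
  obtain ⟨e, he⟩ := exists_wdeg_eq_coe (w := w) hg
  rw [((hasTop_initialForm hd).mul (hasTop_initialForm he)).wdeg_eq
    (mul_ne_zero (initialForm_ne_zero hf) (initialForm_ne_zero hg)), hd, he, WithBot.coe_add]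

theorem wdeg_nonneg (hw : ∀ i, 0 < w i) (hf : f ≠ 0) : 0 ≤ wdeg w f := by
  obtain ⟨m, hm⟩ := support_nonempty.2 hf
  refine le_trans ?_ (Finset.le_sup (f := fun m => ((weight w m : Γ) : WithBot Γ)) hm)
  rw [← WithBot.coe_zero, WithBot.coe_le_coe, weight_apply, Finsupp.sum_fintype _ _ (by simp)]
  exact Finset.sum_nonneg fun i _ => nsmul_nonneg (hw i).le _

theorem eq_C_of_wdeg_le_zero (hw : ∀ i, 0 < w i) (hf : wdeg w f ≤ (0 : Γ)) :
    f = C (coeff 0 f) := by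
  classical
  ext m
  rw [coeff_C]
  split_ifs with hm
  · rw [hm]
  · by_contra h0
    have h := wdeg_le_iff.1 hf m (mem_support_iff.2 h0)
    rw [weight_apply, Finsupp.sum_fintype _ _ (by simp)] at h
    have hnn : ∀ i ∈ Finset.univ, 0 ≤ m i • w i := fun i _ => nsmul_nonneg (hw i).le _
    have := (Finset.sum_eq_zero_iff_of_nonneg hnn).1 (le_antisymm h (Finset.sum_nonneg hnn))
    refine hm (Finsupp.ext fun i => ?_).symm
    by_contra hi
    exact (nsmul_pos (hw i) hi).ne' (this i (Finset.mem_univ i))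

end Ordered

/-! ### Degrees of 2-forms and the chain rule. -/

section Forms

variable {k : Type*} [Field k] {n : ℕ}

/-- The coordinates of `df ∧ dg` are the `2 × 2` minors of the Jacobian matrix. -/
theorem dWedge_repr (f g : MvPolynomial (Fin n) k) (I : Set.powersetCard (Fin n) 2) :
    ∃ i j : Fin n, i ≠ j ∧ (I : Finset (Fin n)) = {i, j} ∧
      ((KaehlerDifferential.mvPolynomialBasis k (Fin n)).exteriorPower 2).repr (dWedge f g) I =
        pderiv i f * pderiv j g - pderiv j f * pderiv i g := by
  classical
  refine ⟨Set.powersetCard.ofFinEmbEquiv.symm I 0, Set.powersetCard.ofFinEmbEquiv.symm I 1,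
    (Set.powersetCard.ofFinEmbEquiv.symm I).injective.ne (by simp), ?_, ?_⟩
  · ext i
    have h := Set.powersetCard.mem_range_ofFinEmbEquiv_symm_iff_mem I i
    rw [Set.powersetCard.mem_coe_iff, ← h]
    simp [Set.mem_range, Fin.exists_fin_two, eq_comm]
  · rw [exteriorPower.basis_repr_apply, dWedge, exteriorPower.ιMultiDual_apply_ιMulti,
      Matrix.det_fin_two]
    simp [Module.Basis.coord_apply, KaehlerDifferential.mvPolynomialBasis_repr_apply]

/-- `f ↦ df ∧ dg` as a derivation. -/
noncomputable def wedgeDer (g : MvPolynomial (Fin n) k) :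
    Derivation k (MvPolynomial (Fin n) k)
      (⋀[MvPolynomial (Fin n) k]^2 (Ω[MvPolynomial (Fin n) k⁄k])) :=
  LinearMap.compDer
    ((exteriorPower.ιMulti (MvPolynomial (Fin n) k) 2).toMultilinearMap.toLinearMap
      ![0, KaehlerDifferential.D k (MvPolynomial (Fin n) k) g] 0)
    (KaehlerDifferential.D k (MvPolynomial (Fin n) k))

theorem wedgeDer_apply (f g : MvPolynomial (Fin n) k) : wedgeDer g f = dWedge f g := by
  simp only [wedgeDer, dWedge]
  change exteriorPower.ιMulti (MvPolynomial (Fin n) k) 2 (Function.update _ _ _) = _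
  congr 1
  ext i
  fin_cases i <;> simp

theorem dWedge_self (f : MvPolynomial (Fin n) k) : dWedge f f = 0 :=
  (exteriorPower.ιMulti (MvPolynomial (Fin n) k) 2).map_eq_zero_of_eq _
    (i := 0) (j := 1) (by simp) (by simp)

theorem dWedge_swap (f g : MvPolynomial (Fin n) k) : dWedge f g = -dWedge g f := by
  have h := (exteriorPower.ιMulti (MvPolynomial (Fin n) k) 2).map_swap
    ![KaehlerDifferential.D k (MvPolynomial (Fin n) k) g,
      KaehlerDifferential.D k (MvPolynomial (Fin n) k) f] (i := 0) (j := 1) (by simp)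
  rw [dWedge, dWedge, ← h]
  congr 1
  ext i
  fin_cases i <;> simp

theorem dWedge_add_left (f f' g : MvPolynomial (Fin n) k) :
    dWedge (f + f') g = dWedge f g + dWedge f' g := by
  simp [← wedgeDer_apply]

theorem dWedge_mul_left (f f' g : MvPolynomial (Fin n) k) :
    dWedge (f * f') g = f • dWedge f' g + f' • dWedge f g := by
  simp [← wedgeDer_apply]

theorem dWedge_C_left (c : k) (g : MvPolynomial (Fin n) k) : dWedge (C c) g = 0 := by
  simp [← wedgeDer_apply]

theorem derivation_aeval {r : ℕ} {A M : Type*} [CommRing A] [Algebra k A] [AddCommGroup M]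
    [Module A M] [Module k M] [IsScalarTower k A M] (δ : Derivation k A M) (F : Fin r → A)
    (P : MvPolynomial (Fin r) k) :
    δ (aeval F P) = ∑ i, aeval F (pderiv i P) • δ (F i) := by
  classical
  induction P using MvPolynomial.induction_on with
  | C a => simp
  | add p q hp hq => simp [hp, hq, add_smul, Finset.sum_add_distrib]
  | mul_X p i hp =>
    simp only [map_mul, aeval_X, Derivation.leibniz, hp, pderiv_X, smul_eq_mul, map_add, add_smul,
      Finset.sum_add_distrib, Finset.smul_sum, mul_smul]
    congr 1
    rw [Finset.sum_eq_single i]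
    · simp
    · intro j _ hj
      simp [Pi.single_eq_of_ne hj.symm]
    · simp

/-- Wedging with `d(F l')` kills one of the two terms of the chain rule. This turns partial
derivatives of `P` into degrees of 2-forms. -/
theorem dWedge_aeval (F : Fin 2 → MvPolynomial (Fin n) k) {l l' : Fin 2} (hl : l ≠ l')
    (P : MvPolynomial (Fin 2) k) :
    dWedge (aeval F P) (F l') = aeval F (pderiv l P) • dWedge (F l) (F l') := by
  rw [← wedgeDer_apply, derivation_aeval]
  simp only [wedgeDer_apply, Fin.sum_univ_two]
  obtain ⟨rfl, rfl⟩ | ⟨rfl, rfl⟩ : (l = 0 ∧ l' = 1) ∨ (l = 1 ∧ l' = 0) := by omega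
  · simp [dWedge_self]
  · simp [dWedge_self]

variable {Γ : Type*} [AddCommGroup Γ] [LinearOrder Γ] {w : Fin n → Γ} {l : ℕ}

theorem formDeg_neg (ω : ⋀[MvPolynomial (Fin n) k]^l (Ω[MvPolynomial (Fin n) k⁄k])) :
    formDeg w (-ω) = formDeg w ω := by
  simp [formDeg]

theorem formDeg_add_le (ω η : ⋀[MvPolynomial (Fin n) k]^l (Ω[MvPolynomial (Fin n) k⁄k])) :
    formDeg w (ω + η) ≤ max (formDeg w ω) (formDeg w η) := by
  simp only [formDeg, map_add, Finsupp.add_apply, add_mul]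
  refine Finset.sup_le fun I hI => wdeg_add_le.trans (max_le_max ?_ ?_)
  · exact Finset.le_sup (f := fun I : Set.powersetCard (Fin n) l =>
      wdeg w ((((KaehlerDifferential.mvPolynomialBasis k (Fin n)).exteriorPower l).repr ω I) *
        ∏ i ∈ (I : Finset (Fin n)), X i)) hI
  · exact Finset.le_sup (f := fun I : Set.powersetCard (Fin n) l =>
      wdeg w ((((KaehlerDifferential.mvPolynomialBasis k (Fin n)).exteriorPower l).repr η I) *
        ∏ i ∈ (I : Finset (Fin n)), X i)) hI

theorem formDeg_add_of_lt {ω η : ⋀[MvPolynomial (Fin n) k]^l (Ω[MvPolynomial (Fin n) k⁄k])}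
    (h : formDeg w ω < formDeg w η) : formDeg w (ω + η) = formDeg w η := by
  refine le_antisymm ((formDeg_add_le ω η).trans (max_le h.le le_rfl)) (not_lt.1 fun hlt => ?_)
  have h1 := formDeg_add_le (w := w) (-ω) (ω + η)
  rw [neg_add_cancel_left, formDeg_neg] at h1
  exact h1.not_gt (max_lt h hlt)

theorem dWedge_swap_formDeg (f g : MvPolynomial (Fin n) k) :
    formDeg w (dWedge f g) = formDeg w (dWedge g f) := by
  rw [dWedge_swap, formDeg_neg]

theorem wdeg_X (i : Fin n) : wdeg w (X i : MvPolynomial (Fin n) k) = w i :=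
  wdeg_of_homogeneous (isWeightedHomogeneous_X k w i) (X_ne_zero i)

variable [IsOrderedAddMonoid Γ]

theorem formDeg_smul (f : MvPolynomial (Fin n) k)
    (ω : ⋀[MvPolynomial (Fin n) k]^l (Ω[MvPolynomial (Fin n) k⁄k])) :
    formDeg w (f • ω) = wdeg w f + formDeg w ω := by
  simp only [formDeg, map_smul, Finsupp.smul_apply, smul_eq_mul, mul_assoc, wdeg_mul]
  refine (Finset.apply_sup_eq_sup_comp (fun x => wdeg w f + x) (fun x y => ?_) ?_).symm
  · exact Monotone.map_max fun _ _ h => by gcongr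
  · simp

theorem wdeg_pderiv_add_le (i : Fin n) (f : MvPolynomial (Fin n) k) :
    wdeg w (pderiv i f) + w i ≤ wdeg w f := by
  by_cases hf : f = 0
  · simp [hf]
  obtain ⟨d, hd⟩ := exists_wdeg_eq_coe (w := w) hf
  have := ((hasTop_initialForm hd).pderiv i).wdeg_le
  calc _ ≤ ((d - w i : Γ) : WithBot Γ) + w i := by gcongr
    _ = wdeg w f := by rw [hd, ← WithBot.coe_add, sub_add_cancel]

/-- The coordinates are Jacobian minors, and the factor `x_i x_j` in the degree of a form makes up
for the weight lost by differentiating. -/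
theorem formDeg_dWedge_le (f g : MvPolynomial (Fin n) k) :
    formDeg w (dWedge f g) ≤ wdeg w f + wdeg w g := by
  have key (i j : Fin n) : wdeg w (pderiv i f * pderiv j g * (X i * X j)) ≤
      wdeg w f + wdeg w g := by
    rw [wdeg_mul, wdeg_mul, wdeg_mul, wdeg_X, wdeg_X, add_add_add_comm]
    exact add_le_add (wdeg_pderiv_add_le i f) (wdeg_pderiv_add_le j g)
  refine Finset.sup_le fun I _ => ?_
  obtain ⟨i, j, hij, hI, h⟩ := dWedge_repr f g I
  rw [h, hI, Finset.prod_pair hij, sub_mul, sub_eq_add_neg]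
  refine wdeg_add_le.trans (max_le (key i j) ?_)
  rw [wdeg_neg, mul_comm (X i)]
  exact key j i

end Forms

/-! ### Multiplicity of a nonzero root of `X^e B(X^p)`. -/

section RootMultiplicity

/-- In characteristic zero `u ≠ 0` is a simple root of `X^p - u^p`, so its multiplicity equals that
of `u^p` in `B`. -/
theorem mul_rootMultiplicity_expand_le {R : Type*} [CommRing R] [IsDomain R] [CharZero R]
    {B : Polynomial R} (hB : B ≠ 0) {u : R} (hu : u ≠ 0) {p : ℕ} (hp : 1 ≤ p) (e : ℕ) :
    p * (Polynomial.X ^ e * Polynomial.expand R p B).rootMultiplicity u ≤ p * B.natDegree := by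
  obtain ⟨B₁, hB₁, hdvd⟩ := B.exists_eq_pow_rootMultiplicity_mul_and_not_dvd hB (u ^ p)
  obtain ⟨S, hS⟩ : (Polynomial.X - Polynomial.C u) ∣
      (Polynomial.X ^ p - Polynomial.C (u ^ p) : Polynomial R) := by
    rw [Polynomial.C_pow]
    exact sub_dvd_pow_sub_pow _ _ p
  have hSu : S.eval u ≠ 0 := by
    have h := congrArg (fun q => (Polynomial.derivative q).eval u) hS
    have h' : (p : R) * u ^ (p - 1) = S.eval u := by
      rw [Polynomial.derivative_sub, Polynomial.derivative_C] at h
      simpa [Polynomial.derivative_X_pow] using h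
    rw [← h']
    exact mul_ne_zero (Nat.cast_ne_zero.2 (Nat.one_le_iff_ne_zero.1 hp)) (pow_ne_zero _ hu)
  have hB₁u : (Polynomial.expand R p B₁).eval u ≠ 0 := by
    rwa [Polynomial.expand_eval, Ne, ← Polynomial.IsRoot, ← Polynomial.dvd_iff_isRoot]
  have hroot : ¬ (Polynomial.X ^ e * S ^ B.rootMultiplicity (u ^ p) *
      Polynomial.expand R p B₁).IsRoot u := by
    rw [Polynomial.IsRoot, Polynomial.eval_mul, Polynomial.eval_mul]
    exact mul_ne_zero (mul_ne_zero (by simp [hu]) (by simp [hSu])) hB₁u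
  have hfac : Polynomial.X ^ e * Polynomial.expand R p B =
      (Polynomial.X ^ e * S ^ B.rootMultiplicity (u ^ p) * Polynomial.expand R p B₁) *
        (Polynomial.X - Polynomial.C u) ^ B.rootMultiplicity (u ^ p) := by
    conv_lhs => rw [hB₁, map_mul, map_pow, map_sub, Polynomial.expand_X, Polynomial.expand_C, hS,
      mul_pow]
    ring
  have hne : Polynomial.X ^ e * S ^ B.rootMultiplicity (u ^ p) *
      Polynomial.expand R p B₁ ≠ 0 := by
    rintro h
    simp [h] at hroot
  rw [hfac, Polynomial.rootMultiplicity_mul_X_sub_C_pow hne,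
    Polynomial.rootMultiplicity_eq_zero hroot, zero_add]
  refine Nat.mul_le_mul_left _ ?_
  have h := congrArg Polynomial.natDegree hB₁
  have hB₁0 : B₁ ≠ 0 := by
    rintro rfl
    simp at hdvd
  rw [Polynomial.natDegree_mul (pow_ne_zero _ (Polynomial.X_sub_C_ne_zero _)) hB₁0,
    Polynomial.natDegree_pow, Polynomial.natDegree_X_sub_C] at h
  omega

end RootMultiplicity

/-! ### Weighted homogeneous polynomials in two variables and their zeros. -/

section Relation

variable {k : Type*} [Field k]

/-- Two polynomials that satisfy a binary homogeneous equation over `k` are proportional. -/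
theorem exists_eq_C_mul_of_binary_form_eq_zero {σ : Type*} {N : ℕ} (A : ℕ → k) (h0 : A 0 ≠ 0)
    (hN : A N ≠ 0) {U V : MvPolynomial σ k} (hU : U ≠ 0) (hV : V ≠ 0)
    (h : ∑ t ∈ Finset.range (N + 1), C (A t) * (U ^ t * V ^ (N - t)) = 0) :
    ∃ c : k, c ≠ 0 ∧ U = C c * V := by
  obtain ⟨U', V', G, hrel, rfl, rfl⟩ := UniqueFactorizationMonoid.exists_reduced_factors U hU V
  have hG : G ≠ 0 := left_ne_zero_of_mul hU
  have h' : ∑ t ∈ Finset.range (N + 1), C (A t) * (U' ^ t * V' ^ (N - t)) = 0 := by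
    refine (mul_eq_zero.1 ?_).resolve_left (pow_ne_zero N hG)
    rw [← h, Finset.mul_sum]
    refine Finset.sum_congr rfl fun t ht => ?_
    have : N = t + (N - t) := by have := Finset.mem_range.1 ht; omega
    conv_lhs => rw [this, pow_add, Nat.add_sub_cancel_left]
    ring
  -- `U'` divides every term except `t = 0`, hence also `V' ^ N`, to which it is coprime. The term
  -- `t = N` serves `V'` in the same way.
  have hU' : IsUnit U' := by
    have hd : U' ∣ V' ^ N := by
      rw [Finset.sum_range_succ', add_comm] at h'
      have h1 : U' ∣ C (A 0) * (U' ^ 0 * V' ^ (N - 0)) := by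
        rw [eq_neg_of_add_eq_zero_left h', dvd_neg]
        exact Finset.dvd_sum fun t _ =>
          ((dvd_pow_self U' (Nat.succ_ne_zero t)).mul_right _).mul_left _
      have hc : IsUnit (C (A 0) : MvPolynomial σ k) := (isUnit_iff_ne_zero.2 h0).map C
      simpa using (hc.dvd_mul_left).1 h1
    exact (hrel.pow_right (n := N)).isUnit_of_dvd hd
  have hV' : IsUnit V' := by
    have hd : V' ∣ U' ^ N := by
      rw [Finset.sum_range_succ, add_comm] at h'
      have h1 : V' ∣ C (A N) * (U' ^ N * V' ^ (N - N)) := by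
        rw [eq_neg_of_add_eq_zero_left h', dvd_neg]
        refine Finset.dvd_sum fun t ht => ?_
        have : N - t ≠ 0 := by have := Finset.mem_range.1 ht; omega
        exact ((dvd_pow_self V' this).mul_left _).mul_left _
      have hc : IsUnit (C (A N) : MvPolynomial σ k) := (isUnit_iff_ne_zero.2 hN).map C
      simpa using (hc.dvd_mul_left).1 h1
    exact (hrel.symm.pow_right (n := N)).isUnit_of_dvd hd
  obtain ⟨a, ha, rfl⟩ := isUnit_iff_eq_C_of_isReduced.1 hU'
  obtain ⟨b, hb, rfl⟩ := isUnit_iff_eq_C_of_isReduced.1 hV'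
  refine ⟨a / b, div_ne_zero ha.ne_zero hb.ne_zero, ?_⟩
  rw [mul_left_comm, ← C_mul, div_mul_cancel₀ _ hb.ne_zero]

theorem weight_fin_two {Γ : Type*} [AddCommGroup Γ] (W : Fin 2 → Γ) {l l' : Fin 2}
    (hl : l ≠ l') (m : Fin 2 →₀ ℕ) :
    weight W m = m l • W l + m l' • W l' := by
  rw [weight_apply, Finsupp.sum_fintype _ _ (by simp), Fin.sum_univ_two]
  obtain ⟨rfl, rfl⟩ | ⟨rfl, rfl⟩ : (l = 0 ∧ l' = 1) ∨ (l = 1 ∧ l' = 0) := by omega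
  · rfl
  · exact add_comm _ _

variable {Γ : Type*} [AddCommGroup Γ] [LinearOrder Γ] [IsOrderedAddMonoid Γ]

/-- The natural solutions of `x α = y β` are the multiples of the primitive one, here `(p, q)`. -/
theorem exists_nat_quotients {a b x y : ℕ} {α β : Γ} (hβ : 0 < β) {p q g : ℕ} (hg : 0 < g)
    (ha : a = p * g) (hb : b = q * g) (hpq : p.Coprime q) (hab : a • α = b • β)
    (hxy : x • α = y • β) (hp : 0 < p) : ∃ t, x = p * t ∧ y = q * t := by
  have h1 : (b * x) • β = (a * y) • β := by
    rw [mul_comm b, mul_smul, ← hab, smul_comm, hxy, ← mul_smul]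
  have h2 : b * x = a * y := (nsmul_left_strictMono hβ).injective h1
  have h3 : q * x = p * y := by
    refine Nat.eq_of_mul_eq_mul_right hg ?_
    calc q * x * g = b * x := by rw [hb]; ring
      _ = p * y * g := by rw [h2, ha]; ring
  obtain ⟨t, rfl⟩ : p ∣ x := hpq.dvd_of_dvd_mul_left (h3 ▸ dvd_mul_right p y)
  refine ⟨t, rfl, Nat.eq_of_mul_eq_mul_left hp ?_⟩
  rw [← h3]
  ring

theorem finsupp_fin_two_ext {l l' : Fin 2} (hl : l ≠ l') {m m' : Fin 2 →₀ ℕ}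
    (h : m l = m' l) (h' : m l' = m' l') : m = m' := by
  ext i
  obtain rfl | rfl : i = l ∨ i = l' := by omega
  exacts [h, h']

/-- The shape of a weighted homogeneous polynomial in two variables that is not a monomial. -/
theorem exists_binary_form {W : Fin 2 → Γ} (hW : ∀ i, 0 < W i) {d : Γ}
    {Q : MvPolynomial (Fin 2) k} (hQ : IsWeightedHomogeneous W Q d) (h0 : Q ≠ 0)
    (hmon : ∀ m c, Q ≠ monomial m c) {l l' : Fin 2} (hl : l ≠ l') :
    ∃ (p q N e r : ℕ) (A : ℕ → k), 1 ≤ p ∧ 1 ≤ q ∧ A 0 ≠ 0 ∧ A N ≠ 0 ∧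
      p • W l = q • W l' ∧ (e + p * N) • W l + r • W l' = d ∧
      Q = ∑ t ∈ Finset.range (N + 1),
        C (A t) * (X l ^ (e + p * t) * X l' ^ (r + q * (N - t))) := by
  classical
  have hwt : ∀ m ∈ Q.support, m l • W l + m l' • W l' = d := fun m hm => by
    rw [← weight_fin_two W hl, hQ (mem_support_iff.1 hm)]
  obtain ⟨m₀, hm₀, hmin⟩ := Finset.exists_min_image Q.support (fun m => m l)
    (support_nonempty.2 h0)
  obtain ⟨m₁, hm₁, hmax⟩ := Finset.exists_max_image Q.support (fun m => m l)
    (support_nonempty.2 h0)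
  have hanti : ∀ m ∈ Q.support, ∀ m' ∈ Q.support, m l ≤ m' l → m' l' ≤ m l' := by
    intro m hm m' hm' hle
    by_contra! hlt
    have h1 := nsmul_le_nsmul_left (hW l).le hle
    have h2 := nsmul_lt_nsmul_left (hW l') hlt
    have h3 := hwt m hm
    have h4 := hwt m' hm'
    grind
  have hdiff : ∀ m ∈ Q.support, ∀ m' ∈ Q.support, m l ≤ m' l →
      (m' l - m l) • W l = (m l' - m' l') • W l' := by
    intro m hm m' hm' hle
    rw [sub_nsmul _ hle, sub_nsmul _ (hanti m hm m' hm' hle)]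
    have h3 := hwt m hm
    have h4 := hwt m' hm'
    grind
  have hlt : m₀ l < m₁ l := by
    by_contra! hle
    refine hmon m₀ (coeff m₀ Q) ?_
    have hsub : Q.support = {m₀} := by
      refine Finset.eq_singleton_iff_unique_mem.2 ⟨hm₀, fun m hm => ?_⟩
      have e1 : m l = m₀ l := le_antisymm ((hmax m hm).trans hle) (hmin m hm)
      exact finsupp_fin_two_ext hl e1
        (le_antisymm (hanti _ hm₀ _ hm e1.ge) (hanti _ hm _ hm₀ e1.le))
    conv_lhs => rw [Q.as_sum, hsub, Finset.sum_singleton]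
  have hab := hdiff m₀ hm₀ m₁ hm₁ hlt.le
  have hb : 0 < m₀ l' - m₁ l' := by
    by_contra! hb
    rw [Nat.le_zero.1 hb, zero_smul] at hab
    exact (nsmul_pos (hW l) (by omega)).ne' hab
  obtain ⟨g, p, q, hg, hpq, ha', hb'⟩ := Nat.exists_coprime' (m := m₁ l - m₀ l)
    (n := m₀ l' - m₁ l') (Nat.gcd_pos_of_pos_right _ hb)
  have hp : 0 < p := by
    rcases Nat.eq_zero_or_pos p with rfl | h
    · omega
    · exact h
  have hq : 0 < q := by
    rcases Nat.eq_zero_or_pos q with rfl | h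
    · omega
    · exact h
  have hle₁ := hanti m₀ hm₀ m₁ hm₁ hlt.le
  -- The support lies on a line; these are the lattice points from `m₀` (`t = 0`) to `m₁` (`t = g`),
  -- with primitive step `(p, -q)`.
  set μ : ℕ → (Fin 2 →₀ ℕ) := fun t =>
    Finsupp.single l (m₀ l + p * t) + Finsupp.single l' (m₁ l' + q * (g - t)) with hμ
  have hμl (t : ℕ) : μ t l = m₀ l + p * t := by simp [hμ, Finsupp.single_eq_of_ne hl]
  have hμl' (t : ℕ) : μ t l' = m₁ l' + q * (g - t) := by
    simp [hμ, Finsupp.single_eq_of_ne hl.symm]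
  have hμ0 : μ 0 = m₀ := finsupp_fin_two_ext hl (by simp [hμl]) (by
    rw [hμl', Nat.sub_zero, ← hb']; omega)
  have hμg : μ g = m₁ := finsupp_fin_two_ext hl (by rw [hμl, ← ha']; omega) (by simp [hμl'])
  have hinj : Function.Injective μ := fun t t' h => by
    have := congrArg (fun m => m l) h
    simp only [hμl, add_right_inj] at this
    exact Nat.eq_of_mul_eq_mul_left hp this
  have hsub : Q.support ⊆ (Finset.range (g + 1)).image μ := by
    intro m hm
    obtain ⟨t, h1, h2⟩ := exists_nat_quotients (hW l') hg ha' hb' hpq hab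
      (hdiff m₀ hm₀ m hm (hmin m hm)) hp
    have h3 := hmin m hm
    have h4 := hmax m hm
    have h5 := hanti m₀ hm₀ m hm h3
    have htg : t ≤ g := by
      refine Nat.le_of_mul_le_mul_left ?_ hp
      omega
    refine Finset.mem_image.2 ⟨t, Finset.mem_range.2 (by omega), finsupp_fin_two_ext hl ?_ ?_⟩
    · rw [hμl]; omega
    · rw [hμl', Nat.mul_sub]
      have := Nat.mul_le_mul_left q htg
      omega
  refine ⟨p, q, g, m₀ l, m₁ l', fun t => coeff (μ t) Q, hp, hq, ?_, ?_, ?_, ?_, ?_⟩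
  · simpa only [hμ0] using mem_support_iff.1 hm₀
  · simpa only [hμg] using mem_support_iff.1 hm₁
  · have h := hab
    rw [ha', hb', mul_comm p, mul_comm q, mul_smul, mul_smul] at h
    exact (nsmul_right_strictMono hg.ne').injective h
  · rw [← hwt m₁ hm₁, ← hμg, hμl, hμl', Nat.sub_self, mul_zero, add_zero]
  · conv_lhs => rw [Q.as_sum]
    rw [Finset.sum_subset hsub fun m _ hm => by rw [notMem_support_iff.1 hm, monomial_zero],
      Finset.sum_image fun _ _ _ _ h => hinj h]
    refine Finset.sum_congr rfl fun t _ => ?_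
    rw [hμ, X_pow_eq_monomial, X_pow_eq_monomial, monomial_mul, C_mul_monomial, one_mul, mul_one]

/-- If a nonzero weighted homogeneous `Q` vanishes at `u`, then `u` satisfies a binomial relation,
and some iterated derivative of `Q` of low order does not vanish at `u`. -/
theorem exists_order_of_vanishing [CharZero k] {σ : Type*} {W : Fin 2 → Γ} (hW : ∀ i, 0 < W i)
    {d : Γ} {Q : MvPolynomial (Fin 2) k} (hQ : IsWeightedHomogeneous W Q d) (h0 : Q ≠ 0)
    {u : Fin 2 → MvPolynomial σ k} (hu : ∀ i, u i ≠ 0) (hQu : aeval u Q = 0)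
    {l l' : Fin 2} (hl : l ≠ l') :
    ∃ p q N : ℕ, 1 ≤ p ∧ 1 ≤ q ∧ p • W l = q • W l' ∧
      (∃ c : k, c ≠ 0 ∧ u l ^ p = C c * u l' ^ q) ∧
      (N + 1) • (p • W l) ≤ d ∧ aeval u ((pderiv l)^[N + 1] Q) ≠ 0 := by
  classical
  have hmon : ∀ m c, Q ≠ monomial m c := by
    rintro m c rfl
    rw [MvPolynomial.aeval_monomial, mul_eq_zero, algebraMap_eq, C_eq_zero,
      Finsupp.prod_eq_zero_iff] at hQu
    obtain rfl | ⟨i, _, hi⟩ := hQu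
    · simp at h0
    · exact pow_ne_zero _ (hu i) hi
  obtain ⟨p, q, N, e, r, A, hp, hq, hA0, hAN, hpq, hd, hsum⟩ :=
    exists_binary_form hW hQ h0 hmon hl
  have hrel : ∑ t ∈ Finset.range (N + 1), C (A t) * ((u l ^ p) ^ t * (u l' ^ q) ^ (N - t)) = 0 := by
    refine (mul_eq_zero.1 ?_).resolve_left
      (mul_ne_zero (pow_ne_zero e (hu l)) (pow_ne_zero r (hu l')))
    rw [← hQu, hsum, map_sum, Finset.mul_sum]
    refine Finset.sum_congr rfl fun t _ => ?_
    simp only [map_mul, map_pow, aeval_X, aeval_C, algebraMap_eq]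
    ring
  have hbin := exists_eq_C_mul_of_binary_form_eq_zero A hA0 hAN (pow_ne_zero p (hu l))
    (pow_ne_zero q (hu l')) hrel
  -- Freezing the variable `l'` at `u l'` makes the order of vanishing the multiplicity of `u l` as
  -- a root of a one-variable polynomial.
  let Y : Fin 2 → Polynomial (MvPolynomial σ k) := fun j =>
    if j = l then Polynomial.X else Polynomial.C (u j)
  have hYl : Y l = Polynomial.X := by simp [Y]
  have hYl' : Y l' = Polynomial.C (u l') := by simp [Y, hl.symm]
  have heval (S : MvPolynomial (Fin 2) k) : (aeval Y S).eval (u l) = aeval u S := by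
    have : ((Polynomial.aeval (R := MvPolynomial σ k) (u l)).restrictScalars k).comp (aeval Y) =
        aeval u := by
      ext i : 1
      obtain rfl | rfl : i = l ∨ i = l' := by omega
      · simp [hYl]
      · simp [hYl']
    rw [← this]
    simp [Polynomial.coe_aeval_eq_eval]
  have hder (S : MvPolynomial (Fin 2) k) :
      Polynomial.derivative (aeval Y S) = aeval Y (pderiv l S) := by
    have h := derivation_aeval ((Polynomial.derivative' (R := MvPolynomial σ k)).restrictScalars k)
      Y S
    have h2 : ∀ i, i ≠ l → Polynomial.derivative (Y i) = 0 := fun i hi => by simp [Y, hi]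
    rw [Finset.sum_eq_single l] at h
    · simpa [Polynomial.derivative', hYl] using h
    · intro i _ hi
      simp [Polynomial.derivative', h2 i hi]
    · simp
  have hiter (m : ℕ) (S : MvPolynomial (Fin 2) k) :
      Polynomial.derivative^[m] (aeval Y S) = aeval Y ((pderiv l)^[m] S) := by
    induction m generalizing S with
    | zero => rfl
    | succ m ih => rw [Function.iterate_succ_apply, hder, ih, Function.iterate_succ_apply]
  let B : Polynomial (MvPolynomial σ k) := ∑ t ∈ Finset.range (N + 1),
    Polynomial.monomial t (C (A t) * u l' ^ (r + q * (N - t)))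
  have hΦ : aeval Y Q = Polynomial.X ^ e * Polynomial.expand _ p B := by
    rw [hsum, map_sum, map_sum, Finset.mul_sum]
    refine Finset.sum_congr rfl fun t _ => ?_
    rw [Polynomial.expand_monomial, ← Polynomial.C_mul_X_pow_eq_monomial]
    simp only [map_mul, map_pow, aeval_X, aeval_C, hYl, hYl',
      IsScalarTower.algebraMap_apply k (MvPolynomial σ k) (Polynomial (MvPolynomial σ k)),
      algebraMap_eq, Polynomial.algebraMap_eq]
    ring
  have hBN : B.coeff N ≠ 0 := by
    simp only [B, Polynomial.finsetSum_coeff, Polynomial.coeff_monomial]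
    rw [Finset.sum_ite_eq' (Finset.range (N + 1)) N, if_pos (by simp)]
    exact mul_ne_zero (C_ne_zero.2 hAN) (pow_ne_zero _ (hu l'))
  have hB0 : B ≠ 0 := by
    rintro h
    simp [h] at hBN
  have hBdeg : B.natDegree ≤ N := by
    refine Polynomial.natDegree_sum_le_of_forall_le _ _ fun t ht => ?_
    exact (Polynomial.natDegree_monomial_le _).trans (by have := Finset.mem_range.1 ht; omega)
  have hΦ0 : aeval Y Q ≠ 0 := by
    rw [hΦ]
    exact mul_ne_zero (pow_ne_zero _ Polynomial.X_ne_zero)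
      ((Polynomial.expand_ne_zero (by omega)).2 hB0)
  have hroot : (aeval Y Q).IsRoot (u l) := by rw [Polynomial.IsRoot, heval, hQu]
  have hpos := (Polynomial.rootMultiplicity_pos hΦ0).2 hroot
  -- The multiplicity is positive because `Q` vanishes at `u`; the derivative of exactly this order
  -- is the first that survives.
  obtain ⟨M, hM⟩ : ∃ M, (aeval Y Q).rootMultiplicity (u l) = M + 1 :=
    ⟨_, (Nat.succ_pred hpos.ne').symm⟩
  refine ⟨p, q, M, hp, hq, hpq, hbin, ?_, ?_⟩
  · have h1 := mul_rootMultiplicity_expand_le hB0 (hu l) hp e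
    rw [← hΦ, hM] at h1
    have h2 : (M + 1) * p ≤ e + p * N := by
      have := Nat.mul_le_mul_left p hBdeg
      rw [mul_comm]
      omega
    rw [← mul_smul, ← hd]
    exact (nsmul_le_nsmul_left (hW l).le h2).trans
      (le_add_of_nonneg_right (nsmul_nonneg (hW l').le r))
  · rw [← heval, ← hiter, ← hM, Polynomial.eval_iterate_derivative_rootMultiplicity, nsmul_eq_mul]
    exact mul_ne_zero (Nat.cast_ne_zero.2 (Nat.factorial_ne_zero _))
      (Polynomial.eval_divByMonic_pow_rootMultiplicity_ne_zero _ hΦ0)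

end Relation

/-! ### The lower bound for the degree of `h ∈ k[f, g]` when leading terms cancel. -/

section DegreeDrop

variable {k : Type*} [Field k] {Γ : Type*} [AddCommGroup Γ] [LinearOrder Γ]
  [IsOrderedAddMonoid Γ] {n : ℕ} {w : Fin n → Γ}

/-- One step is the estimate of `dP(F) ∧ d(F l')` from above by the degrees of its two factors,
after the chain rule; the bound is then iterated. -/
theorem wdeg_iterate_pderiv_le {F : Fin 2 → MvPolynomial (Fin n) k} {l l' : Fin 2} (hl : l ≠ l')
    {D e' : Γ} (hD : formDeg w (dWedge (F l) (F l')) = D) (he' : wdeg w (F l') = e')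
    (P : MvPolynomial (Fin 2) k) (m : ℕ) {b : Γ}
    (hb : wdeg w (aeval F ((pderiv l)^[m] P)) = b) :
    ∃ a : Γ, wdeg w (aeval F P) = a ∧ b + m • D ≤ a + m • e' := by
  induction m generalizing P with
  | zero => exact ⟨b, hb, by simp⟩
  | succ m ih =>
    obtain ⟨a₁, ha₁, h₁⟩ := ih (pderiv l P) (by rwa [← Function.iterate_succ_apply])
    have h := formDeg_dWedge_le (w := w) (aeval F P) (F l')
    rw [dWedge_aeval F hl, formDeg_smul, ha₁, hD, he'] at h
    have hne : aeval F P ≠ 0 := by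
      intro h0
      rw [h0, wdeg_zero, WithBot.bot_add, ← WithBot.coe_add, le_bot_iff] at h
      exact WithBot.coe_ne_bot h
    obtain ⟨a, ha⟩ := exists_wdeg_eq_coe (w := w) hne
    rw [ha, ← WithBot.coe_add, ← WithBot.coe_add, WithBot.coe_le_coe] at h
    refine ⟨a, ha, ?_⟩
    rw [succ_nsmul, succ_nsmul]
    grind

/-- The consequences, in the direction of `f`, of a degree drop of `h ∈ k[f, g]`: here `df`, `dg`,
`dh` are the degrees of `f`, `g`, `h`, `D` is the degree of `df ∧ dg`, and `d` is the formal
degree of `h` as a polynomial in `f` and `g`. -/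
def DropBound (w : Fin n → Γ) (f g h : MvPolynomial (Fin n) k) (df dg dh D d : Γ) : Prop :=
  ∃ (p q : ℕ) (c : k) (E : Γ), 1 ≤ p ∧ 1 ≤ q ∧ p • df = q • dg ∧ c ≠ 0 ∧
    initialForm w f ^ p = C c * initialForm w g ^ q ∧
    p • df + D ≤ dh + df + dg ∧
    formDeg w (dWedge h g) = E ∧
    (df + dg ≤ p • df + D → p • df + D ≤ E + df) ∧
    (dh + 2 • (df + dg) < 2 • (p • df + D) → E + df = d + D)

theorem dropBound_aeval [CharZero k] {F : Fin 2 → MvPolynomial (Fin n) k} {W : Fin 2 → Γ}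
    (hF : ∀ i, wdeg w (F i) = W i) (hW : ∀ i, 0 < W i) (hF0 : ∀ i, F i ≠ 0)
    {P : MvPolynomial (Fin 2) k} {d dh D : Γ} (hd : wdeg W P = d)
    (hdh : wdeg w (aeval F P) = dh) (hdh0 : 0 ≤ dh)
    (hvan : aeval (fun i => initialForm w (F i)) (initialForm W P) = 0)
    {l l' : Fin 2} (hl : l ≠ l') (hD : formDeg w (dWedge (F l) (F l')) = D) :
    DropBound w (F l) (F l') (aeval F P) (W l) (W l') dh D d := by
  have hP0 : P ≠ 0 := by
    rintro rfl
    simp at hd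
  have hPtop := hasTop_initialForm hd
  have hFtop : ∀ i, HasTop w (F i) (W i) (initialForm w (F i)) := fun i =>
    hasTop_initialForm (hF i)
  obtain ⟨p, q, N, hp, hq, hpq, ⟨c, hc, hrel⟩, hNd, hne⟩ :=
    exists_order_of_vanishing hW hPtop.1 (initialForm_ne_zero hP0)
      (fun i => initialForm_ne_zero (hF0 i)) hvan hl
  have hb := (HasTop.aeval hFtop (hPtop.iterate_pderiv l (N + 1))).wdeg_eq hne
  -- The first of the `N + 1` derivatives is kept apart, because its degree `e` determines that of
  -- `dh ∧ dg`, namely `e + D`.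
  obtain ⟨e, he, h1⟩ := wdeg_iterate_pderiv_le hl hD (hF l') (pderiv l P) N
    (by rwa [← Function.iterate_succ_apply])
  have h0 : e + D ≤ dh + W l' := by
    have h := formDeg_dWedge_le (w := w) (aeval F P) (F l')
    rwa [dWedge_aeval F hl, formDeg_smul, he, hD, hF l', hdh, ← WithBot.coe_add,
      ← WithBot.coe_add, WithBot.coe_le_coe] at h
  have h2 : e ≤ d - W l := by
    have h := (HasTop.aeval hFtop (hPtop.pderiv l)).wdeg_le
    rwa [he, WithBot.coe_le_coe] at h
  set s := p • W l + D - W l - W l' with hs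
  have h3 : p • W l - W l + N • s ≤ e := by
    rw [hs, nsmul_sub, nsmul_sub, nsmul_add]
    rw [succ_nsmul] at h1 hNd
    grind
  have h4 : s + N • s ≤ dh := by grind
  -- Immediate from `h4` if `s ≥ 0`; a negative `s` is covered by `dh ≥ 0`.
  have h5 : s ≤ dh := by
    by_contra! hlt
    have := nsmul_nonneg (hdh0.trans hlt.le) N
    grind
  refine ⟨p, q, c, e + D, hp, hq, hpq, hc, hrel, by grind, ?_, ?_, ?_⟩
  · rw [dWedge_aeval F hl, formDeg_smul, he, hD, WithBot.coe_add]
  · intro h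
    have := nsmul_nonneg (a := s) (by grind) N
    grind
  · intro h
    -- Now `dh < 2s` while `(N + 1) s ≤ dh`. With a simple zero the degree of the first derivative
    -- is exactly its formal degree.
    have hN : N = 0 := by
      by_contra hN
      have hs0 : 0 ≤ s := by grind
      have := nsmul_le_nsmul_left hs0 (Nat.one_le_iff_ne_zero.2 hN)
      rw [one_nsmul] at this
      grind
    subst hN
    rw [zero_nsmul, zero_nsmul, add_zero, add_zero, zero_add, one_nsmul] at h1
    grind

/-- A Shestakov-Umirbaev type inequality: if the initial form of `h ∈ k[f, g]` does not lie in
`k[f^w, g^w]`, then the degree of `h` cannot be too small. -/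
theorem exists_dropBound [CharZero k] {f g h : MvPolynomial (Fin n) k} {df dg dh D : Γ}
    (hf : wdeg w f = df) (hg : wdeg w g = dg) (hh : wdeg w h = dh) (hf0 : 0 < df) (hg0 : 0 < dg)
    (hh0 : 0 ≤ dh) (hD : formDeg w (dWedge f g) = D) (hmem : h ∈ Algebra.adjoin k {f, g})
    (hnot : initialForm w h ∉ Algebra.adjoin k {initialForm w f, initialForm w g}) :
    ∃ d : Γ, DropBound w f g h df dg dh D d ∧ DropBound w g f h dg df dh D d := by
  have hrange (a b : MvPolynomial (Fin n) k) : ({a, b} : Set _) = Set.range ![a, b] := by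
    simp [Matrix.range_cons, Set.pair_comm]
  rw [hrange, Algebra.adjoin_range_eq_range_aeval] at hmem hnot
  obtain ⟨P, rfl⟩ := hmem
  have hne {x : MvPolynomial (Fin n) k} {dx : Γ} (hx : wdeg w x = dx) : x ≠ 0 := by
    rintro rfl
    simp at hx
  have hP0 : P ≠ 0 := by
    rintro rfl
    exact hne hh (map_zero _)
  obtain ⟨d, hd⟩ := exists_wdeg_eq_coe (w := ![df, dg]) hP0
  have hF : ∀ i, wdeg w (![f, g] i) = ((![df, dg] i : Γ) : WithBot Γ) := by
    intro i
    fin_cases i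
    exacts [hf, hg]
  have hW : ∀ i, 0 < ![df, dg] i := by
    intro i
    fin_cases i
    exacts [hf0, hg0]
  -- If it did not vanish, this value would be `h^w`, an element of `k[f^w, g^w]`.
  have hvan : aeval (fun i => initialForm w (![f, g] i)) (initialForm ![df, dg] P) = 0 := by
    by_contra h0
    refine hnot ⟨initialForm ![df, dg] P, ?_⟩
    have := (HasTop.aeval (fun i => hasTop_initialForm (hF i))
      (hasTop_initialForm hd)).initialForm_eq h0
    refine Eq.trans ?_ this.symm
    refine congrArg (fun F => aeval F (initialForm ![df, dg] P)) (funext fun i => ?_)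
    fin_cases i <;> rfl
  refine ⟨d, ?_, ?_⟩
  · exact dropBound_aeval (l := 0) (l' := 1) hF hW (fun i => hne (hF i)) hd hh hh0 hvan
      (by simp) hD
  · exact dropBound_aeval (l := 1) (l' := 0) hF hW (fun i => hne (hF i)) hd hh hh0 hvan
      (by simp) (by rw [dWedge_swap_formDeg]; exact hD)

end DegreeDrop

/-! ### Proportionality, initial spaces and positivity of degrees. -/

section InitialForms

variable {k : Type*} [Field k] {n : ℕ}

theorem approx_of_eq {x y : MvPolynomial (Fin n) k} {c : k} (h : x = C c * y) : Approx x y := by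
  intro hli
  have := LinearIndependent.pair_iff.1 hli 1 (-c) (by rw [h, smul_eq_C_mul, smul_eq_C_mul]; simp)
  simp at this

theorem Approx.exists_eq {x y : MvPolynomial (Fin n) k} (h : Approx x y) (hx : x ≠ 0)
    (hy : y ≠ 0) : ∃ c : k, c ≠ 0 ∧ x = C c * y := by
  rw [Approx, LinearIndependent.pair_iff] at h
  push Not at h
  obtain ⟨s, t, hst, hne⟩ := h
  have hs : s ≠ 0 := by
    rintro rfl
    rw [zero_smul, zero_add] at hst
    exact (smul_eq_zero.1 hst).elim (hne rfl) hy
  have ht : t ≠ 0 := by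
    rintro rfl
    rw [zero_smul, add_zero] at hst
    exact (smul_eq_zero.1 hst).elim hs hx
  refine ⟨-(s⁻¹ * t), by simp [hs, ht], ?_⟩
  rw [← smul_eq_C_mul, neg_smul, mul_smul, eq_neg_of_add_eq_zero_right hst]
  simp [smul_smul, hs]

/-- If `x` is proportional to `v - b x`, then it is proportional to `v`. -/
theorem exists_eq_C_mul_of_eq_C_mul_sub {x v : MvPolynomial (Fin n) k} (hx : x ≠ 0) (hv : v ≠ 0)
    {b c : k} (h : x = C c * (v - C b * x)) : ∃ c' : k, x = C c' * v := by
  have h1 : C (1 + c * b) * x = C c * v := by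
    rw [C_add, C_mul, C_1]
    linear_combination h
  by_cases h0 : 1 + c * b = 0
  · rw [h0, C_0, zero_mul, eq_comm, mul_eq_zero, C_eq_zero] at h1
    obtain rfl | h1 := h1
    · simp [hx] at h
    · exact absurd h1 hv
  · refine ⟨(1 + c * b)⁻¹ * c, ?_⟩
    rw [C_mul, mul_assoc, ← h1, ← mul_assoc, ← C_mul, inv_mul_cancel₀ h0, C_1, one_mul]

variable {Γ : Type*} [AddCommGroup Γ] [LinearOrder Γ] {w : Fin n → Γ}

/-- Elements of the same degree may be added before top parts are taken, so each homogeneous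
component of an element of `V^w` is itself the top part of a single element of `V`. -/
theorem exists_initialForm_eq_of_mem_initialSpace {V : Submodule k (MvPolynomial (Fin n) k)}
    {f : MvPolynomial (Fin n) k} {d : Γ} (hf : wdeg w f = d)
    (h : initialForm w f ∈ initialSpace w V) :
    ∃ g ∈ V, wdeg w g = d ∧ initialForm w g = initialForm w f := by
  classical
  have hf0 : f ≠ 0 := by
    rintro rfl
    simp at hf
  have key : ∀ x ∈ initialSpace w V, ∃ g ∈ V,
      HasTop w g d (weightedHomogeneousComponent w d x) := by
    intro x hx
    induction hx using Submodule.span_induction with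
    | mem x hx =>
      obtain ⟨g, hg, hg0, rfl⟩ := hx
      obtain ⟨e, he⟩ := exists_wdeg_eq_coe (w := w) hg0
      have ht := hasTop_initialForm he
      by_cases hed : e = d
      · subst hed
        exact ⟨g, hg, by rwa [ht.1.weightedHomogeneousComponent_same]⟩
      · exact ⟨0, V.zero_mem, by
          rw [ht.1.weightedHomogeneousComponent_ne _ (Ne.symm hed)]
          exact HasTop.zero_of_lt (by simp)⟩
    | zero => exact ⟨0, V.zero_mem, by rw [map_zero]; exact HasTop.zero_of_lt (by simp)⟩
    | add x y _ _ hx hy =>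
      obtain ⟨g, hg, hgt⟩ := hx
      obtain ⟨g', hg', hgt'⟩ := hy
      exact ⟨g + g', V.add_mem hg hg', by rw [map_add]; exact hgt.add hgt'⟩
    | smul c x _ hx =>
      obtain ⟨g, hg, hgt⟩ := hx
      refine ⟨c • g, V.smul_mem c hg, ?_⟩
      rw [map_smul]
      refine ⟨(weightedHomogeneousSubmodule k w d).smul_mem c hgt.1, ?_⟩
      rw [← smul_sub]
      refine wdeg_lt_iff.2 fun m hm => wdeg_lt_iff.1 hgt.2 m ?_
      exact support_smul hm
  obtain ⟨g, hg, hgt⟩ := key _ h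
  rw [(hasTop_initialForm hf).1.weightedHomogeneousComponent_same] at hgt
  exact ⟨g, hg, hgt.wdeg_eq (initialForm_ne_zero hf0), hgt.initialForm_eq (initialForm_ne_zero hf0)⟩

/-- By homogeneity only the monomials of weight `d` contribute; if the exponents are determined by
the weight, just one remains. -/
theorem exists_monomial_of_mem_adjoin {a b x : MvPolynomial (Fin n) k} {α β d : Γ}
    (ha : IsWeightedHomogeneous w a α) (hb : IsWeightedHomogeneous w b β)
    (hx : IsWeightedHomogeneous w x d) (hx0 : x ≠ 0) (h : x ∈ Algebra.adjoin k {a, b}) :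
    ∃ i j : ℕ, i • α + j • β = d ∧
      ((∀ i' j' : ℕ, i' • α + j' • β = d → i' = i ∧ j' = j) →
        ∃ c : k, c ≠ 0 ∧ x = C c * (a ^ i * b ^ j)) := by
  classical
  have hspan : x ∈ Submodule.span k
      {y | ∃ i j : ℕ, i • α + j • β = d ∧ y = a ^ i * b ^ j} := by
    rw [show ({a, b} : Set (MvPolynomial (Fin n) k)) = Set.range ![a, b] by
      simp [Matrix.range_cons, Set.pair_comm], Algebra.adjoin_range_eq_range_aeval] at h
    obtain ⟨P, hP⟩ := h
    change aeval ![a, b] P = x at hP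
    rw [← hx.weightedHomogeneousComponent_same, ← hP, P.as_sum, map_sum, map_sum]
    refine Submodule.sum_mem _ fun m _ => ?_
    have hmon : aeval ![a, b] (monomial m (coeff m P)) = C (coeff m P) * (a ^ m 0 * b ^ m 1) := by
      rw [MvPolynomial.aeval_monomial, Finsupp.prod_fintype _ _ (by simp), Fin.prod_univ_two]
      rfl
    have hhom : IsWeightedHomogeneous w (C (coeff m P) * (a ^ m 0 * b ^ m 1))
        (m 0 • α + m 1 • β) := ((ha.pow _).mul (hb.pow _)).C_mul _
    rw [hmon]
    by_cases hd : m 0 • α + m 1 • β = d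
    · rw [← hd, hhom.weightedHomogeneousComponent_same, ← smul_eq_C_mul]
      exact Submodule.smul_mem _ _ (Submodule.subset_span ⟨_, _, rfl, rfl⟩)
    · rw [hhom.weightedHomogeneousComponent_ne _ (Ne.symm hd)]
      exact Submodule.zero_mem _
  obtain ⟨i, j, hij⟩ : ∃ i j : ℕ, i • α + j • β = d := by
    by_contra! hno
    have : {y | ∃ i j : ℕ, i • α + j • β = d ∧ y = a ^ i * b ^ j} = ∅ :=
      Set.eq_empty_of_forall_notMem fun y ⟨i, j, hij, _⟩ => hno i j hij
    rw [this, Submodule.span_empty, Submodule.mem_bot] at hspan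
    exact hx0 hspan
  refine ⟨i, j, hij, fun huniq => ?_⟩
  have : {y | ∃ i j : ℕ, i • α + j • β = d ∧ y = a ^ i * b ^ j} ⊆ {a ^ i * b ^ j} := by
    rintro y ⟨i', j', h', rfl⟩
    obtain ⟨rfl, rfl⟩ := huniq i' j' h'
    rfl
  obtain ⟨c, hc⟩ := Submodule.mem_span_singleton.1 (Submodule.span_mono this hspan)
  refine ⟨c, ?_, by rw [← hc, smul_eq_C_mul]⟩
  rintro rfl
  exact hx0 (by rw [← hc, zero_smul])

variable [IsOrderedAddMonoid Γ]

theorem exists_wdeg_pos (hw : ∀ i, 0 < w i) {ι : Type*} {F : ι → MvPolynomial (Fin n) k}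
    (hF : AlgebraicIndependent k F) (i : ι) : ∃ d : Γ, 0 < d ∧ wdeg w (F i) = d := by
  obtain ⟨d, hd⟩ := exists_wdeg_eq_coe (w := w) (hF.ne_zero i)
  refine ⟨d, ?_, hd⟩
  by_contra! h
  have hC := eq_C_of_wdeg_le_zero hw (hd.le.trans (WithBot.coe_le_coe.2 h))
  refine hF.transcendental i ?_
  rw [hC]
  exact isAlgebraic_algebraMap _

theorem formDeg_dWedge_pos (hw : ∀ i, 0 < w i) {f g : MvPolynomial (Fin n) k} {D : Γ}
    (hD : formDeg w (dWedge f g) = D) : 0 < D := by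
  have hne : (Finset.univ : Finset (Set.powersetCard (Fin n) 2)).Nonempty := by
    by_contra h
    rw [Finset.not_nonempty_iff_eq_empty] at h
    rw [formDeg, h, Finset.sup_empty] at hD
    exact WithBot.bot_ne_coe hD
  obtain ⟨I, _, hI⟩ := Finset.exists_mem_eq_sup _ hne fun I : Set.powersetCard (Fin n) 2 =>
    wdeg w ((((KaehlerDifferential.mvPolynomialBasis k (Fin n)).exteriorPower 2).repr
      (dWedge f g) I) * ∏ i ∈ (I : Finset (Fin n)), X i)
  rw [← formDeg, hD] at hI
  obtain ⟨i, j, hij, hIij, -⟩ := dWedge_repr f g I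
  rw [hIij, Finset.prod_pair hij, wdeg_mul, wdeg_mul, wdeg_X, wdeg_X] at hI
  have h0 : ((KaehlerDifferential.mvPolynomialBasis k (Fin n)).exteriorPower 2).repr
      (dWedge f g) I ≠ 0 := by
    intro h0
    rw [h0, wdeg_zero, WithBot.bot_add] at hI
    exact WithBot.coe_ne_bot hI
  obtain ⟨e, he⟩ := exists_wdeg_eq_coe (w := w) h0
  have he0 := wdeg_nonneg hw h0
  rw [he, ← WithBot.coe_zero, WithBot.coe_le_coe] at he0
  rw [he, ← WithBot.coe_add, ← WithBot.coe_add, WithBot.coe_inj] at hI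
  rw [hI]
  exact add_pos_of_nonneg_of_pos he0 (add_pos (hw i) (hw j))

end InitialForms

/-! ### The numerical data of an SU pair and the excluded proportionalities. -/

section SU

variable {k : Type*} [Field k] {Γ : Type*} [AddCommGroup Γ] [LinearOrder Γ] {n : ℕ}
  {w : Fin n → Γ} {F G : Fin 3 → MvPolynomial (Fin n) k}

/-- The degrees attached to a pair satisfying the Shestakov-Umirbaev condition, and the
inequalities between them. -/
structure SUData (w : Fin n → Γ) (F G : Fin 3 → MvPolynomial (Fin n) k) (a b c : k)
    (δ α D e₁ e₃ E E' : Γ) : Prop where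
  eq_zero : G 0 = F 0 + C a * F 2 ^ 2 + C c * F 2
  eq_one : G 1 = F 1 + C b * F 2
  δ_pos : 0 < δ
  D_pos : 0 < D
  odd : ∃ r : ℕ, α = (2 * r + 1) • δ
  α_cases : α = 3 • δ ∨ 5 • δ ≤ α
  wdeg_G_zero : wdeg w (G 0) = α
  wdeg_G_one : wdeg w (G 1) = (2 • δ : Γ)
  wdeg_F_zero : wdeg w (F 0) = e₁
  wdeg_F_one : wdeg w (F 1) = (2 • δ : Γ)
  wdeg_F_two : wdeg w (F 2) = e₃
  e₁_pos : 0 < e₁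
  e₁_le : e₁ ≤ α
  e₃_le : e₃ ≤ α
  notMem : initialForm w (F 2) ∉ Algebra.adjoin k {initialForm w (G 0), initialForm w (G 1)}
  formDeg_G : formDeg w (dWedge (G 0) (G 1)) = D
  formDeg_two_one : formDeg w (dWedge (F 2) (F 1)) = E
  formDeg_two_zero : formDeg w (dWedge (F 2) (F 0)) = E'
  le_e₃ : α + D ≤ e₃ + 2 • δ
  le_E : α + D ≤ E
  le_E' : 2 • α + D ≤ E' + 2 • δ
  E'_le : E' ≤ e₃ + e₁
  exact : e₃ + 4 • δ < 2 • α + 2 • D → E + α = E' + 2 • δ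

variable {a b c : k} {δ α D e₁ e₃ E E' : Γ}

namespace SUData

theorem initialForm_ne (H : SUData w F G a b c δ α D e₁ e₃ E E') :
    initialForm w (F 0) ≠ 0 ∧ initialForm w (F 1) ≠ 0 ∧ initialForm w (F 2) ≠ 0 ∧
      initialForm w (G 0) ≠ 0 ∧ initialForm w (G 1) ≠ 0 := by
  have key {x : MvPolynomial (Fin n) k} {d : Γ} (h : wdeg w x = d) : initialForm w x ≠ 0 := by
    refine initialForm_ne_zero ?_
    rintro rfl
    simp at h
  exact ⟨key H.wdeg_F_zero, key H.wdeg_F_one, key H.wdeg_F_two, key H.wdeg_G_zero,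
    key H.wdeg_G_one⟩

theorem ne_C_mul_G_zero (H : SUData w F G a b c δ α D e₁ e₃ E E') (t : k) :
    initialForm w (F 2) ≠ C t * initialForm w (G 0) := by
  intro h
  refine H.notMem (h ▸ ?_)
  exact Subalgebra.mul_mem _ (Subalgebra.algebraMap_mem _ t) (Algebra.subset_adjoin (by simp))

theorem ne_C_mul_G_one_pow (H : SUData w F G a b c δ α D e₁ e₃ E E') (t : k) (j : ℕ) :
    initialForm w (F 2) ≠ C t * initialForm w (G 1) ^ j := by
  intro h
  refine H.notMem (h ▸ ?_)
  exact Subalgebra.mul_mem _ (Subalgebra.algebraMap_mem _ t)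
    (Subalgebra.pow_mem _ (Algebra.subset_adjoin (by simp)) _)

/-- Used to read off `deg (df₁ ∧ df₂)` from the dominant term on the right. -/
theorem dWedge_zero_one (H : SUData w F G a b c δ α D e₁ e₃ E E') :
    dWedge (F 0) (F 1) = dWedge (G 0) (G 1) + ((C b : MvPolynomial (Fin n) k) • dWedge (F 2) (F 0) -
      (C a * F 2 + C a * F 2 + C c) • dWedge (F 2) (F 1)) := by
  have h0 : dWedge (G 0) (F 1) = dWedge (F 0) (F 1) +
      (C a * F 2 + C a * F 2 + C c) • dWedge (F 2) (F 1) := by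
    rw [H.eq_zero, dWedge_add_left, dWedge_add_left, dWedge_mul_left, dWedge_mul_left, sq,
      dWedge_mul_left]
    simp only [dWedge_C_left, smul_zero, add_zero]
    module
  have h1 : dWedge (F 2) (G 0) = dWedge (F 2) (F 0) := by
    rw [dWedge_swap, dWedge_swap (F 2), H.eq_zero, dWedge_add_left,
      dWedge_add_left, dWedge_mul_left, dWedge_mul_left, sq, dWedge_mul_left]
    simp [dWedge_self, dWedge_C_left]
  have h2 : dWedge (G 1) (G 0) =
      dWedge (F 1) (G 0) + (C b : MvPolynomial (Fin n) k) • dWedge (F 2) (G 0) := by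
    rw [H.eq_one, dWedge_add_left, dWedge_mul_left]
    simp [dWedge_C_left]
  rw [dWedge_swap (G 0), h2, h1, dWedge_swap (F 1), h0]
  module

end SUData

variable [IsOrderedAddMonoid Γ]

theorem nsmul_two_ne_odd {δ : Γ} (hδ : 0 < δ) (q p r : ℕ) (hp : Odd p) :
    p • ((2 * r + 1) • δ) ≠ q • (2 • δ) := by
  intro h
  rw [← mul_smul, ← mul_smul] at h
  have := (nsmul_left_strictMono hδ).injective h
  have h2 : Odd (p * (2 * r + 1)) := hp.mul ⟨r, rfl⟩
  rw [this] at h2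
  exact (Nat.not_odd_iff_even.2 ⟨q, by ring⟩) h2

theorem SUCondition.exists_data [CharZero k] (hw : ∀ i, 0 < w i) (hF : AlgebraicIndependent k F)
    (hG : AlgebraicIndependent k G) (h : SUCondition w F G) :
    ∃ (a b c : k) (δ α D e₁ e₃ E E' : Γ), SUData w F G a b c δ α D e₁ e₃ E E' := by
  obtain ⟨⟨a, b, c, hG0, hG1⟩, hmem⟩ := h.su1
  obtain ⟨α, hα0, hα⟩ := exists_wdeg_pos hw hG 0
  obtain ⟨τ, hτ0, hτ⟩ := exists_wdeg_pos hw hG 1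
  obtain ⟨γ, hγ0, hγ⟩ := exists_wdeg_pos hw hG 2
  obtain ⟨e₁, he₁0, he₁⟩ := exists_wdeg_pos hw hF 0
  obtain ⟨e₂, he₂0, he₂⟩ := exists_wdeg_pos hw hF 1
  obtain ⟨e₃, he₃0, he₃⟩ := exists_wdeg_pos hw hF 2
  obtain ⟨s, ⟨r, rfl⟩, hs3, happ⟩ := h.su3
  have hu0 := initialForm_ne_zero (w := w) (hG.ne_zero 0)
  have hv0 := initialForm_ne_zero (w := w) (hG.ne_zero 1)
  obtain ⟨c₀, hc₀, hc₀'⟩ := happ.exists_eq (pow_ne_zero _ hu0) (pow_ne_zero _ hv0)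
  have hατ : 2 • α = (2 * r + 1) • τ := by
    refine IsWeightedHomogeneous.inj_right (pow_ne_zero _ hu0)
      ((hasTop_initialForm hα).1.pow 2) ?_
    rw [hc₀']
    exact ((hasTop_initialForm hτ).1.pow _).C_mul _
  -- From `2α = (2r + 1)τ` one gets `τ = 2(α - rτ)`, so `τ` is divisible by 2 in `Γ`.
  obtain ⟨δ, rfl⟩ : ∃ δ, τ = 2 • δ := ⟨α - r • τ, by
    rw [add_smul, mul_smul, one_smul] at hατ
    rw [nsmul_sub, hατ]
    abel⟩
  have hδ : 0 < δ := by grind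
  have hαδ : α = (2 * r + 1) • δ := by
    rw [smul_comm] at hατ
    exact (nsmul_right_strictMono (M := Γ) (n := 2) (by simp)).injective hατ
  have hαc : α = 3 • δ ∨ 5 • δ ≤ α := by
    obtain rfl | hr : r = 1 ∨ 2 ≤ r := by omega
    · exact Or.inl hαδ
    · exact Or.inr (hαδ ▸ nsmul_le_nsmul_left hδ.le (by omega))
  have hα3 : 3 • δ ≤ α := by grind
  have hDne : formDeg w (dWedge (G 0) (G 1)) ≠ ⊥ := by
    intro h0
    have := h.su6
    rw [h0, WithBot.add_bot] at this
    exact not_lt_bot this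
  obtain ⟨D, hD'⟩ := WithBot.ne_bot_iff_exists.1 hDne
  have hD := hD'.symm
  have hD0 := formDeg_dWedge_pos hw hD
  have h6 : γ + 2 • δ < α + D := by
    have := h.su6
    rwa [hγ, hτ, hα, hD, ← WithBot.coe_add, ← WithBot.coe_add, WithBot.coe_lt_coe] at this
  have h5 : γ < e₃ := by
    have := h.su5
    rwa [hγ, he₃, WithBot.coe_lt_coe] at this
  have h41 : e₃ ≤ α := by
    have := h.su4.1
    rwa [he₃, hα, WithBot.coe_le_coe] at this
  have h21 : e₁ ≤ α := by
    have := h.su2.1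
    rwa [he₁, hα, WithBot.coe_le_coe] at this
  have h22 := h.su2.2
  have hGtop : HasTop w (G 2) e₃ 0 := HasTop.zero_of_lt (hγ ▸ WithBot.coe_lt_coe.2 h5)
  have hx0 := initialForm_ne_zero (w := w) (hF.ne_zero 2)
  have hhtop : HasTop w (F 2 - G 2) e₃ (initialForm w (F 2)) := by
    simpa using (hasTop_initialForm he₃).sub hGtop
  have hhmem : F 2 - G 2 ∈ Algebra.adjoin k {G 0, G 1} := by
    rw [← neg_sub]
    exact neg_mem hmem
  -- The inequality for `f₃ - g₃` in both directions; the common formal degree `d` is what later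
  -- links `E` and `E'`.
  obtain ⟨d, ⟨p, q, c₁, E, hp, hq, hpq, -, -, hb, hE, hE1, hE2⟩,
      ⟨q', p', c₂, E', hq', hp', hpq', -, -, hb', hE', hE1', hE2'⟩⟩ :=
    exists_dropBound hα hτ (hhtop.wdeg_eq hx0) hα0 hτ0 he₃0.le hD hhmem
      (by rw [hhtop.initialForm_eq hx0]; exact h.su4.2)
  have hp2 : 2 • α ≤ p • α := by
    refine nsmul_le_nsmul_left hα0.le ?_
    by_contra! hlt
    obtain rfl : p = 1 := by omega
    exact nsmul_two_ne_odd hδ q 1 r odd_one (hαδ ▸ hpq)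
  have hp2' : 2 • α ≤ q' • 2 • δ := by
    rw [hpq']
    refine nsmul_le_nsmul_left hα0.le ?_
    by_contra! hlt
    obtain rfl : p' = 1 := by omega
    exact nsmul_two_ne_odd hδ q' 1 r odd_one (hαδ ▸ hpq'.symm)
  -- By condition 6 the contribution of `g₃` is below `α + D ≤ E`, so `f₃ - g₃` can be replaced by
  -- `f₃`.
  have hEF : formDeg w (dWedge (F 2) (G 1)) = E := by
    rw [show F 2 = G 2 + (F 2 - G 2) by ring, dWedge_add_left, formDeg_add_of_lt, hE]
    refine (formDeg_dWedge_le _ _).trans_lt ?_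
    rw [hE, hγ, hτ, ← WithBot.coe_add, WithBot.coe_lt_coe]
    grind
  have hEF' : formDeg w (dWedge (F 2) (G 0)) = E' := by
    rw [show F 2 = G 2 + (F 2 - G 2) by ring, dWedge_add_left, formDeg_add_of_lt, hE']
    refine (formDeg_dWedge_le _ _).trans_lt ?_
    rw [hE', hγ, hα, ← WithBot.coe_add, WithBot.coe_lt_coe]
    grind
  have hF1 : formDeg w (dWedge (F 2) (F 1)) = E := by
    rw [dWedge_swap_formDeg, ← hEF, dWedge_swap_formDeg (F 2), hG1, dWedge_add_left,
      dWedge_mul_left]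
    simp [dWedge_self, dWedge_C_left]
  have hF0 : formDeg w (dWedge (F 2) (F 0)) = E' := by
    rw [dWedge_swap_formDeg, ← hEF', dWedge_swap_formDeg (F 2), hG0, dWedge_add_left,
      dWedge_add_left, dWedge_mul_left, dWedge_mul_left, sq, dWedge_mul_left]
    simp [dWedge_self, dWedge_C_left]
  refine ⟨a, b, c, δ, α, D, e₁, e₃, E, E', hG0, hG1, hδ, hD0, ⟨r, hαδ⟩, hαc, hα, hτ, he₁,
    h22.trans hτ, he₃, he₁0, h21, h41, h.su4.2, hD, hF1, hF0, by grind, by grind, by grind, ?_,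
    by grind⟩
  have := formDeg_dWedge_le (w := w) (F 2) (F 0)
  rwa [hF0, he₃, he₁, ← WithBot.coe_add, WithBot.coe_le_coe] at this

namespace SUData

theorem lt_e₃ (H : SUData w F G a b c δ α D e₁ e₃ E E') : δ + D ≤ e₃ := by
  have := H.le_e₃
  have := H.α_cases
  have := H.δ_pos
  grind

theorem hasTop_quadratic (H : SUData w F G a b c δ α D e₁ e₃ E E') :
    HasTop w (C a * F 2 ^ 2 + C c * F 2) (2 • e₃) (C a * initialForm w (F 2) ^ 2) := by
  have h1 := ((hasTop_initialForm H.wdeg_F_two).pow 2).C_mul a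
  have h2 : HasTop w (C c * F 2) (2 • e₃) 0 := by
    refine HasTop.zero_of_lt
      (((hasTop_initialForm H.wdeg_F_two).C_mul c).wdeg_le.trans_lt (WithBot.coe_lt_coe.2 ?_))
    have := H.lt_e₃
    have := H.δ_pos
    have := H.D_pos
    grind
  simpa using h1.add h2

theorem two_e₃_le (H : SUData w F G a b c δ α D e₁ e₃ E E') (ha : a ≠ 0) :
    2 • e₃ ≤ α := by
  have h := H.hasTop_quadratic.wdeg_eq (mul_ne_zero (C_ne_zero.2 ha)
    (pow_ne_zero _ H.initialForm_ne.2.2.1))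
  have h2 : C a * F 2 ^ 2 + C c * F 2 = G 0 + -F 0 := by rw [H.eq_zero]; ring
  have h3 := wdeg_add_le (w := w) (f := G 0) (g := -F 0)
  rw [← h2, h, wdeg_neg, H.wdeg_G_zero, H.wdeg_F_zero, ← WithBot.coe_max,
    WithBot.coe_le_coe, max_eq_left H.e₁_le] at h3
  exact h3

theorem e₃_le_of_b_ne (H : SUData w F G a b c δ α D e₁ e₃ E E') (hb : b ≠ 0) :
    e₃ ≤ 2 • δ := by
  have h := ((hasTop_initialForm H.wdeg_F_two).C_mul b).wdeg_eq
    (mul_ne_zero (C_ne_zero.2 hb) H.initialForm_ne.2.2.1)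
  have h2 : C b * F 2 = G 1 + -F 1 := by rw [H.eq_one]; ring
  have h3 := wdeg_add_le (w := w) (f := G 1) (g := -F 1)
  rw [← h2, h, wdeg_neg, H.wdeg_G_one, H.wdeg_F_one, max_self, WithBot.coe_le_coe] at h3
  exact h3

/-- Here `g₁^w` is the initial form of `a f₃² + c f₃`; with `a = 0` it would be proportional to
`f₃^w`. -/
theorem of_e₁_lt (H : SUData w F G a b c δ α D e₁ e₃ E E') (hlt : e₁ < α) :
    a ≠ 0 ∧ 2 • e₃ = α := by
  have h2 : G 0 - F 0 = C a * F 2 ^ 2 + C c * F 2 := by rw [H.eq_zero]; ring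
  have hu := H.initialForm_ne.2.2.2.1
  have hF0 : HasTop w (F 0) α 0 :=
    HasTop.zero_of_lt (H.wdeg_F_zero ▸ WithBot.coe_lt_coe.2 hlt)
  have h1 := (hasTop_initialForm H.wdeg_G_zero).sub hF0
  rw [sub_zero, h2] at h1
  have ha : a ≠ 0 := by
    rintro rfl
    have hc : c ≠ 0 := by
      rintro rfl
      have := h1.wdeg_eq hu
      simp at this
    rw [C_0, zero_mul, zero_add] at h1
    have h3 := (hasTop_initialForm H.wdeg_F_two).C_mul c
    have h4 := h3.initialForm_eq (mul_ne_zero (C_ne_zero.2 hc) H.initialForm_ne.2.2.1)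
    rw [h1.initialForm_eq hu] at h4
    refine H.ne_C_mul_G_zero c⁻¹ ?_
    rw [h4, ← mul_assoc, ← C_mul, inv_mul_cancel₀ hc, C_1, one_mul]
  have h3 := H.hasTop_quadratic.wdeg_eq (mul_ne_zero (C_ne_zero.2 ha)
    (pow_ne_zero _ H.initialForm_ne.2.2.1))
  rw [h1.wdeg_eq hu, WithBot.coe_inj] at h3
  exact ⟨ha, h3.symm⟩

/-- `2e₃ ≤ α` and `α + D ≤ e₃ + 2δ` give `α < 4δ`, which excludes `5δ ≤ α`. -/
theorem α_eq_of_a_ne (H : SUData w F G a b c δ α D e₁ e₃ E E') (ha : a ≠ 0) : α = 3 • δ := by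
  have := H.two_e₃_le ha
  have := H.le_e₃
  have := H.D_pos
  have := H.δ_pos
  have := H.α_cases
  grind

theorem α_eq_of_b_ne (H : SUData w F G a b c δ α D e₁ e₃ E E') (hb : b ≠ 0) : α = 3 • δ := by
  have := H.e₃_le_of_b_ne hb
  have := H.le_e₃
  have := H.D_pos
  have := H.δ_pos
  have := H.α_cases
  grind

theorem le_e₁ (H : SUData w F G a b c δ α D e₁ e₃ E E') (hlt : e₁ < α) :
    5 • δ + 2 • D ≤ 2 • e₁ ∧ α = 3 • δ ∧ 2 • e₃ = 3 • δ := by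
  obtain ⟨ha, h1⟩ := H.of_e₁_lt hlt
  have := H.α_eq_of_a_ne ha
  have := H.le_E'
  have := H.E'_le
  grind

/-- If `b ≠ 0`, degrees force `j = 1`, and then `f₂^w = g₂^w - b f₃^w` would make `f₃^w`
proportional to `g₂^w`. -/
theorem ne_C_mul_F_one_pow (H : SUData w F G a b c δ α D e₁ e₃ E E') (t : k) (j : ℕ) :
    initialForm w (F 2) ≠ C t * initialForm w (F 1) ^ j := by
  intro h
  have hx := H.initialForm_ne.2.2.1
  by_cases hb : b = 0
  · have hG := H.eq_one
    rw [hb, C_0, zero_mul, add_zero] at hG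
    exact H.ne_C_mul_G_one_pow t j (hG ▸ h)
  have hle := H.e₃_le_of_b_ne hb
  have hlt := H.lt_e₃
  have hδ := H.δ_pos
  have hD := H.D_pos
  have hj : e₃ = j • (2 • δ) := by
    refine IsWeightedHomogeneous.inj_right hx (hasTop_initialForm H.wdeg_F_two).1 ?_
    rw [h]
    exact ((hasTop_initialForm H.wdeg_F_one).1.pow j).C_mul t
  obtain rfl | rfl | hj2 : j = 0 ∨ j = 1 ∨ 2 ≤ j := by omega
  · rw [zero_smul] at hj
    grind
  · rw [one_smul] at hj
    have htop : HasTop w (F 1) (2 • δ) (initialForm w (G 1) - C b * initialForm w (F 2)) := by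
      have := (hasTop_initialForm H.wdeg_G_one).sub
        (hj ▸ (hasTop_initialForm H.wdeg_F_two).C_mul b)
      rwa [H.eq_one, add_sub_cancel_right, ← H.eq_one] at this
    rw [pow_one, (hasTop_initialForm H.wdeg_F_one).eq htop] at h
    obtain ⟨t', ht'⟩ := exists_eq_C_mul_of_eq_C_mul_sub hx H.initialForm_ne.2.2.2.2 h
    exact H.ne_C_mul_G_one_pow t' 1 (by rwa [pow_one])
  · have := nsmul_le_nsmul_left (a := 2 • δ) (by grind) hj2
    grind

/-- Equal degrees force `e₁ = α` and `a = 0`; then `f₁^w = g₁^w - c f₃^w` would make `f₃^w`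
proportional to `g₁^w`. -/
theorem ne_C_mul_F_zero (H : SUData w F G a b c δ α D e₁ e₃ E E') (t : k) :
    initialForm w (F 2) ≠ C t * initialForm w (F 0) := by
  intro h
  have hx := H.initialForm_ne.2.2.1
  have hδ := H.δ_pos
  have hD := H.D_pos
  have he : e₃ = e₁ := by
    refine IsWeightedHomogeneous.inj_right hx (hasTop_initialForm H.wdeg_F_two).1 ?_
    rw [h]
    exact (hasTop_initialForm H.wdeg_F_zero).1.C_mul t
  obtain hlt | heq := H.e₁_le.lt_or_eq
  · have := H.le_e₁ hlt
    grind
  have ha : a = 0 := by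
    by_contra ha
    have := H.two_e₃_le ha
    have := H.lt_e₃
    grind
  have htop : HasTop w (F 0) e₁ (initialForm w (G 0) - C c * initialForm w (F 2)) := by
    have h1 := hasTop_initialForm H.wdeg_G_zero
    rw [← heq] at h1
    have h2 := (hasTop_initialForm H.wdeg_F_two).C_mul c
    rw [he] at h2
    have := h1.sub h2
    have hG : G 0 = F 0 + C c * F 2 := by simp [H.eq_zero, ha]
    rwa [hG, add_sub_cancel_right, ← hG] at this
  rw [(hasTop_initialForm H.wdeg_F_zero).eq htop] at h
  obtain ⟨t', ht'⟩ := exists_eq_C_mul_of_eq_C_mul_sub hx H.initialForm_ne.2.2.2.1 h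
  exact H.ne_C_mul_G_zero t' ht'

end SUData

end SU

/-! ### The three non-membership statements and elementary reductions. -/

section SU

variable {k : Type*} [Field k] {Γ : Type*} [AddCommGroup Γ] [LinearOrder Γ]
  [IsOrderedAddMonoid Γ] {n : ℕ}
  {w : Fin n → Γ} {F G : Fin 3 → MvPolynomial (Fin n) k}
  {a b c : k} {δ α D e₁ e₃ E E' : Γ}

namespace SUData

theorem two_δ_lt_e₁ (H : SUData w F G a b c δ α D e₁ e₃ E E') : 2 • δ < e₁ := by
  have hδ := H.δ_pos
  have hD := H.D_pos
  obtain hlt | heq := H.e₁_le.lt_or_eq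
  · have := H.le_e₁ hlt
    grind
  · have := H.α_cases
    grind

theorem notMem_initialSpace_zero [CharZero k] (H : SUData w F G a b c δ α D e₁ e₃ E E')
    (hsq : ¬ Approx (initialForm w (F 0)) (initialForm w (F 2) ^ 2)) :
    initialForm w (F 0) ∉ initialSpace w (Algebra.adjoin k {F 1, F 2}).toSubmodule := by
  intro hmem
  obtain ⟨h, hh, hdeg, hin⟩ := exists_initialForm_eq_of_mem_initialSpace H.wdeg_F_zero hmem
  have hδ := H.δ_pos
  have hD := H.D_pos
  have hα := H.α_cases
  have he₃ := H.lt_e₃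
  have hle := H.le_e₃
  have hle₁ := H.e₁_le
  have h2e := H.two_δ_lt_e₁
  obtain ⟨hx₀, hx₁, hx₂, -, -⟩ := H.initialForm_ne
  by_cases hdrop : initialForm w h ∈
      Algebra.adjoin k {initialForm w (F 1), initialForm w (F 2)}
  · rw [hin] at hdrop
    obtain ⟨i, j, hij, huniq⟩ := exists_monomial_of_mem_adjoin
      (hasTop_initialForm H.wdeg_F_one).1 (hasTop_initialForm H.wdeg_F_two).1
      (hasTop_initialForm H.wdeg_F_zero).1 hx₀ hdrop
    obtain hlt | heq := hle₁.lt_or_eq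
    -- Now `2e₃ = 3δ` and `5δ/2 < e₁ < 3δ`, an interval without values of `2δ i + e₃ j`.
    · have h3 := H.le_e₁ hlt
      have hi : i = 0 ∨ i = 1 ∨ 2 ≤ i := by omega
      have hj : j = 0 ∨ j = 1 ∨ 2 ≤ j := by omega
      have hi2 : 2 ≤ i → 2 • (2 • δ) ≤ i • (2 • δ) := nsmul_le_nsmul_left (by grind)
      have hj2 : 2 ≤ j → 2 • e₃ ≤ j • e₃ := nsmul_le_nsmul_left (by grind)
      have hi0 := nsmul_nonneg (a := 2 • δ) (by grind) i
      have hj0 := nsmul_nonneg (a := e₃) (by grind) j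
      rcases hi with rfl | rfl | hi
      · rcases hj with rfl | rfl | hj
        · simp only [zero_nsmul] at hij; grind
        · simp only [zero_nsmul, one_nsmul] at hij; grind
        · have := hj2 hj
          obtain rfl | hj3 : j = 2 ∨ 3 ≤ j := by omega
          · simp only [zero_nsmul] at hij; grind
          · have := nsmul_le_nsmul_left (a := e₃) (by grind) hj3
            simp only [zero_nsmul] at hij; grind
      · rcases hj with rfl | rfl | hj
        · simp only [zero_nsmul, one_nsmul] at hij; grind
        · simp only [one_nsmul] at hij; grind
        · have := hj2 hj
          simp only [one_nsmul] at hij; grind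
      · have := hi2 hi
        grind
    · have hsol : ∀ i' j' : ℕ, i' • (2 • δ) + j' • e₃ = e₁ →
          i' = 0 ∧ (j' = 1 ∧ e₃ = e₁ ∨ j' = 2 ∧ 2 • e₃ = e₁) := by
        intro i' j' h'
        have hi0 := nsmul_nonneg (a := 2 • δ) (by grind) i'
        have hi1 : 1 ≤ i' → 1 • (2 • δ) ≤ i' • (2 • δ) := nsmul_le_nsmul_left (by grind)
        obtain rfl | rfl | rfl | hj : j' = 0 ∨ j' = 1 ∨ j' = 2 ∨ 3 ≤ j' := by omega
        · obtain ⟨r, hr⟩ := H.odd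
          exfalso
          refine nsmul_two_ne_odd hδ i' 1 r odd_one ?_
          rw [← hr, one_smul, ← heq, ← h', zero_smul, add_zero]
        · obtain rfl | hi : i' = 0 ∨ 1 ≤ i' := by omega
          · simp only [zero_nsmul, one_nsmul] at h'
            exact ⟨rfl, Or.inl ⟨rfl, by grind⟩⟩
          · have := hi1 hi
            grind
        · obtain rfl | hi : i' = 0 ∨ 1 ≤ i' := by omega
          · simp only [zero_nsmul] at h'
            exact ⟨rfl, Or.inr ⟨rfl, by grind⟩⟩
          · have := hi1 hi
            grind
        · have := nsmul_le_nsmul_left (a := e₃) (by grind) hj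
          grind
      obtain ⟨rfl, hj⟩ := hsol i j hij
      obtain ⟨t, ht, hteq⟩ := huniq fun i' j' h' => by
        obtain ⟨rfl, hj'⟩ := hsol i' j' h'
        grind
      rw [pow_zero, one_mul] at hteq
      obtain ⟨rfl, -⟩ | ⟨rfl, -⟩ := hj
      · refine H.ne_C_mul_F_zero t⁻¹ ?_
        rw [hteq, pow_one, ← mul_assoc, ← C_mul, inv_mul_cancel₀ ht, C_1, one_mul]
      · exact hsq (approx_of_eq hteq)
  -- With `E ≥ α + D` and `e₁ ≤ α` the inequality becomes `q e₃ + D ≤ 2δ + e₃`. Together with `e₃ ≥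
  -- δ + D` this leaves `q = 1`, where `f₃^w` is proportional to a power of `f₂^w`.
  · have hEs : formDeg w (dWedge (F 1) (F 2)) = E := by
      rw [dWedge_swap_formDeg, H.formDeg_two_one]
    obtain ⟨d, ⟨p, q, t, -, hp, hq, hpq, ht, hteq, hb, -⟩, -⟩ :=
      exists_dropBound H.wdeg_F_one H.wdeg_F_two hdeg (by grind) (by grind) H.e₁_pos.le hEs hh hdrop
    have hE := H.le_E
    obtain rfl | rfl | hq3 : q = 1 ∨ q = 2 ∨ 3 ≤ q := by omega
    · refine H.ne_C_mul_F_one_pow t⁻¹ p ?_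
      rw [hteq, pow_one, ← mul_assoc, ← C_mul, inv_mul_cancel₀ ht, C_1, one_mul]
    · obtain rfl | hp2 : p = 1 ∨ 2 ≤ p := by omega
      · simp only [one_nsmul] at hpq hb
        grind
      · have := nsmul_le_nsmul_left (a := 2 • δ) (by grind) hp2
        grind
    · have := nsmul_le_nsmul_left (a := e₃) (by grind) hq3
      grind

theorem notMem_initialSpace_one [CharZero k] (H : SUData w F G a b c δ α D e₁ e₃ E E') :
    initialForm w (F 1) ∉ initialSpace w (Algebra.adjoin k {F 0, F 2}).toSubmodule := by
  intro hmem
  obtain ⟨h, hh, hdeg, hin⟩ := exists_initialForm_eq_of_mem_initialSpace H.wdeg_F_one hmem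
  have hδ := H.δ_pos
  have hD := H.D_pos
  have hα := H.α_cases
  have he₃ := H.lt_e₃
  have hle := H.le_e₃
  have hle₁ := H.e₁_le
  have h2e := H.two_δ_lt_e₁
  obtain ⟨hx₀, hx₁, hx₂, -, -⟩ := H.initialForm_ne
  by_cases hdrop : initialForm w h ∈
      Algebra.adjoin k {initialForm w (F 0), initialForm w (F 2)}
  · rw [hin] at hdrop
    obtain ⟨i, j, hij, huniq⟩ := exists_monomial_of_mem_adjoin
      (hasTop_initialForm H.wdeg_F_zero).1 (hasTop_initialForm H.wdeg_F_two).1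
      (hasTop_initialForm H.wdeg_F_one).1 hx₁ hdrop
    have hsol : ∀ i' j' : ℕ, i' • e₁ + j' • e₃ = 2 • δ → i' = 0 ∧ j' = 1 := by
      intro i' j' h'
      have hj0 := nsmul_nonneg (a := e₃) (by grind) j'
      have hi1 : 1 ≤ i' → 1 • e₁ ≤ i' • e₁ := nsmul_le_nsmul_left (by grind)
      have hj2 : 2 ≤ j' → 2 • e₃ ≤ j' • e₃ := nsmul_le_nsmul_left (by grind)
      obtain rfl | hi : i' = 0 ∨ 1 ≤ i' := by omega
      · obtain rfl | rfl | hj : j' = 0 ∨ j' = 1 ∨ 2 ≤ j' := by omega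
        · simp only [zero_nsmul] at h'; grind
        · exact ⟨rfl, rfl⟩
        · have := hj2 hj
          simp only [zero_nsmul] at h'; grind
      · have := hi1 hi
        grind
    obtain ⟨rfl, rfl⟩ := hsol i j hij
    obtain ⟨t, ht, hteq⟩ := huniq hsol
    refine H.ne_C_mul_F_one_pow t⁻¹ 1 ?_
    rw [hteq, pow_zero, one_mul, pow_one, pow_one, ← mul_assoc, ← C_mul, inv_mul_cancel₀ ht, C_1,
      one_mul]
  -- The bound `2α + D ≤ E' + 2δ` rules out `e₁ < α` and `p ≥ 2`. For `p = 1` it forces `α = 3δ` and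
  -- `e₃ ≥ 2δ + D`, so `q = 1` and `f₁^w`, `f₃^w` would be proportional.
  · have hEs : formDeg w (dWedge (F 0) (F 2)) = E' := by
      rw [dWedge_swap_formDeg, H.formDeg_two_zero]
    obtain ⟨d, ⟨p, q, t, -, hp, hq, hpq, ht, hteq, hb, -⟩, -⟩ :=
      exists_dropBound H.wdeg_F_zero H.wdeg_F_two hdeg H.e₁_pos (by grind) (by grind) hEs hh hdrop
    have hE := H.le_E'
    have hle₃ := H.e₃_le
    have hp1 := nsmul_le_nsmul_left H.e₁_pos.le hp
    obtain hlt | heq := hle₁.lt_or_eq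
    · have h3 := H.le_e₁ hlt
      grind
    · obtain rfl | hp2 : p = 1 ∨ 2 ≤ p := by omega
      · obtain rfl | hq2 : q = 1 ∨ 2 ≤ q := by omega
        · refine H.ne_C_mul_F_zero t⁻¹ ?_
          rw [← pow_one (initialForm w (F 0)), hteq, pow_one, ← mul_assoc, ← C_mul,
            inv_mul_cancel₀ ht, C_1, one_mul]
        · have := nsmul_le_nsmul_left (a := e₃) (by grind) hq2
          simp only [one_nsmul] at hpq hb
          grind
      · have := nsmul_le_nsmul_left H.e₁_pos.le hp2
        grind

theorem formDeg_zero_one_of_a_ne (H : SUData w F G a b c δ α D e₁ e₃ E E') (ha : a ≠ 0)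
    [CharZero k] : formDeg w (dWedge (F 0) (F 1)) = (e₃ + E : Γ) := by
  have hδ := H.δ_pos
  have hD := H.D_pos
  have hα := H.α_eq_of_a_ne ha
  have h2e := H.two_e₃_le ha
  have he₃ := H.lt_e₃
  have hE := H.le_E
  -- With `α = 3δ` this reads `E' = E + δ`, less than `e₃ + E`; the term with coefficient `2a f₃ +
  -- c` therefore dominates.
  have hex := H.exact (by grind)
  have hcoef : wdeg w (C a * F 2 + C a * F 2 + C c) = e₃ := by
    have h1 := (hasTop_initialForm H.wdeg_F_two).C_mul a
    have h2 : HasTop w (C c) e₃ 0 := HasTop.zero_of_lt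
      ((HasTop.const c).wdeg_le.trans_lt (WithBot.coe_lt_coe.2 (by grind)))
    refine ((h1.add h1).add h2).wdeg_eq ?_
    rw [add_zero, ← two_mul]
    exact mul_ne_zero two_ne_zero (mul_ne_zero (C_ne_zero.2 ha) H.initialForm_ne.2.2.1)
  have h3 : formDeg w (-((C a * F 2 + C a * F 2 + C c) • dWedge (F 2) (F 1))) = (e₃ + E : Γ) := by
    rw [formDeg_neg, formDeg_smul, hcoef, H.formDeg_two_one, WithBot.coe_add]
  have h4 : formDeg w ((C b : MvPolynomial (Fin n) k) • dWedge (F 2) (F 0)) < (e₃ + E : Γ) := by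
    rw [formDeg_smul, H.formDeg_two_zero]
    refine (add_le_add_left (HasTop.const b).wdeg_le _).trans_lt ?_
    rw [← WithBot.coe_add, WithBot.coe_lt_coe]
    grind
  have h5 : formDeg w (dWedge (G 0) (G 1)) < (e₃ + E : Γ) := by
    rw [H.formDeg_G, WithBot.coe_lt_coe]
    grind
  rw [H.dWedge_zero_one, sub_eq_add_neg, formDeg_add_of_lt]
  · rw [formDeg_add_of_lt, h3]
    rwa [h3]
  · rw [formDeg_add_of_lt, h3]
    · exact h5
    · rwa [h3]

theorem formDeg_zero_one_of_b_ne (H : SUData w F G a b c δ α D e₁ e₃ E E') (ha : a = 0)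
    (hb : b ≠ 0) : formDeg w (dWedge (F 0) (F 1)) = E' := by
  have hδ := H.δ_pos
  have hD := H.D_pos
  have hα := H.α_eq_of_b_ne hb
  have h2e := H.e₃_le_of_b_ne hb
  have hE := H.le_E
  -- Again `E' = E + δ`; as `a = 0`, the term `c df₃ ∧ df₂` is now smaller than `b df₃ ∧ df₁`.
  have hex := H.exact (by grind)
  have h3 : formDeg w ((C b : MvPolynomial (Fin n) k) • dWedge (F 2) (F 0)) = E' := by
    rw [formDeg_smul, (HasTop.const b).wdeg_eq (C_ne_zero.2 hb), H.formDeg_two_zero,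
      WithBot.coe_zero, zero_add]
  have h4 : formDeg w (-((C a * F 2 + C a * F 2 + C c) • dWedge (F 2) (F 1))) < E' := by
    rw [formDeg_neg, formDeg_smul, H.formDeg_two_one, ha, C_0, zero_mul, zero_add, zero_add]
    refine (add_le_add_left (HasTop.const c).wdeg_le _).trans_lt ?_
    rw [← WithBot.coe_add, WithBot.coe_lt_coe]
    grind
  have h5 : formDeg w (dWedge (G 0) (G 1)) < E' := by
    rw [H.formDeg_G, WithBot.coe_lt_coe]
    grind
  rw [H.dWedge_zero_one, sub_eq_add_neg, add_comm ((C b : MvPolynomial (Fin n) k) • _),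
    formDeg_add_of_lt]
  · rw [formDeg_add_of_lt, h3]
    rwa [h3]
  · rw [formDeg_add_of_lt, h3]
    · exact h5
    · rwa [h3]

theorem formDeg_zero_one_of_c_ne (H : SUData w F G a b c δ α D e₁ e₃ E E') (ha : a = 0)
    (hb : b = 0) (hc : c ≠ 0) : formDeg w (dWedge (F 0) (F 1)) = E := by
  have hδ := H.δ_pos
  have hα := H.α_cases
  have hE := H.le_E
  have h3 : formDeg w ((C b : MvPolynomial (Fin n) k) • dWedge (F 2) (F 0) -
      (C a * F 2 + C a * F 2 + C c) • dWedge (F 2) (F 1)) = E := by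
    simp only [ha, hb, C_0, zero_mul, zero_add, zero_smul, zero_sub]
    rw [formDeg_neg, formDeg_smul, (HasTop.const c).wdeg_eq (C_ne_zero.2 hc), H.formDeg_two_one,
      WithBot.coe_zero, zero_add]
  rw [H.dWedge_zero_one, formDeg_add_of_lt, h3]
  rw [h3, H.formDeg_G, WithBot.coe_lt_coe]
  grind

theorem notMem_initialSpace_two [CharZero k] (H : SUData w F G a b c δ α D e₁ e₃ E E')
    (hne : (F 0, F 1) ≠ (G 0, G 1)) :
    initialForm w (F 2) ∉ initialSpace w (Algebra.adjoin k {F 0, F 1}).toSubmodule := by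
  intro hmem
  obtain ⟨h, hh, hdeg, hin⟩ := exists_initialForm_eq_of_mem_initialSpace H.wdeg_F_two hmem
  have hδ := H.δ_pos
  have hD := H.D_pos
  have hα := H.α_cases
  have he₃ := H.lt_e₃
  have hle := H.le_e₃
  have hle₁ := H.e₁_le
  have hle₃ := H.e₃_le
  have h2e := H.two_δ_lt_e₁
  obtain ⟨hx₀, hx₁, hx₂, -, -⟩ := H.initialForm_ne
  by_cases hdrop : initialForm w h ∈
      Algebra.adjoin k {initialForm w (F 0), initialForm w (F 1)}
  · rw [hin] at hdrop
    obtain ⟨i, j, hij, huniq⟩ := exists_monomial_of_mem_adjoin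
      (hasTop_initialForm H.wdeg_F_zero).1 (hasTop_initialForm H.wdeg_F_one).1
      (hasTop_initialForm H.wdeg_F_two).1 hx₂ hdrop
    have hsol : ∀ i' j' : ℕ, i' • e₁ + j' • (2 • δ) = e₃ →
        i' = 0 ∨ i' = 1 ∧ j' = 0 ∧ e₁ = α ∧ e₃ = α := by
      intro i' j' h'
      have hj0 := nsmul_nonneg (a := 2 • δ) (by grind) j'
      have hi1 : 1 ≤ i' → 1 • e₁ ≤ i' • e₁ := nsmul_le_nsmul_left H.e₁_pos.le
      have hi2 : 2 ≤ i' → 2 • e₁ ≤ i' • e₁ := nsmul_le_nsmul_left H.e₁_pos.le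
      have hj1 : 1 ≤ j' → 1 • (2 • δ) ≤ j' • (2 • δ) := nsmul_le_nsmul_left (by grind)
      obtain rfl | hi : i' = 0 ∨ 1 ≤ i' := by omega
      · exact Or.inl rfl
      have := hi1 hi
      obtain hlt | heq := hle₁.lt_or_eq
      · have h3 := H.le_e₁ hlt
        grind
      · right
        obtain rfl | hi' : i' = 1 ∨ 2 ≤ i' := by omega
        · obtain rfl | hj : j' = 0 ∨ 1 ≤ j' := by omega
          · simp only [zero_nsmul, one_nsmul] at h'
            exact ⟨rfl, rfl, heq, by grind⟩
          · have := hj1 hj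
            grind
        · have := hi2 hi'
          grind
    have hodd : ∀ j' : ℕ, j' • (2 • δ) ≠ α := fun j' h' => by
      obtain ⟨r, hr⟩ := H.odd
      refine nsmul_two_ne_odd hδ j' 1 r odd_one ?_
      rw [← hr, one_smul, h']
    obtain rfl | ⟨rfl, rfl, heq, heq'⟩ := hsol i j hij
    · have hinj := (nsmul_left_strictMono (a := 2 • δ) (by grind)).injective
      rw [zero_smul, zero_add] at hij
      obtain ⟨t, -, hteq⟩ := huniq fun i' j' h' => by
        obtain rfl | ⟨rfl, rfl, h1, h2⟩ := hsol i' j' h'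
        · rw [zero_smul, zero_add] at h'
          exact ⟨rfl, hinj (h'.trans hij.symm)⟩
        · exact absurd (hij.trans h2) (hodd j)
      rw [pow_zero, one_mul] at hteq
      exact H.ne_C_mul_F_one_pow t j hteq
    · obtain ⟨t, -, hteq⟩ := huniq fun i' j' h' => by
        obtain rfl | ⟨rfl, rfl, -, -⟩ := hsol i' j' h'
        · rw [zero_smul, zero_add] at h'
          exact absurd (h'.trans heq') (hodd j')
        · exact ⟨rfl, rfl⟩
      rw [pow_zero, mul_one, pow_one] at hteq
      exact H.ne_C_mul_F_zero t hteq
  -- Each nonzero coefficient among `a`, `b`, `c` makes `D'` too large for this bound; when only `c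
  -- ≠ 0`, parity is also needed, to exclude `p = 1`.
  · have hbound {D' : Γ} (hD' : formDeg w (dWedge (F 0) (F 1)) = D') :
        ∃ p q : ℕ, 1 ≤ p ∧ p • e₁ = q • (2 • δ) ∧ p • e₁ + D' ≤ e₃ + e₁ + 2 • δ := by
      obtain ⟨d, ⟨p, q, t, -, hp, -, hpq, -, -, hb, -⟩, -⟩ :=
        exists_dropBound H.wdeg_F_zero H.wdeg_F_one hdeg H.e₁_pos (by grind) (by grind) hD' hh hdrop
      exact ⟨p, q, hp, hpq, hb⟩
    have hE := H.le_E
    have hE' := H.le_E'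
    by_cases ha : a = 0
    · by_cases hb : b = 0
      · have hc : c ≠ 0 := by
          rintro rfl
          refine hne ?_
          rw [H.eq_zero, H.eq_one, ha, hb]
          simp
        have he₁ : e₁ = α := by
          by_contra hlt
          exact (H.of_e₁_lt (lt_of_le_of_ne hle₁ hlt)).1 ha
        obtain ⟨p, q, hp, hpq, hle'⟩ := hbound (H.formDeg_zero_one_of_c_ne ha hb hc)
        obtain rfl | hp2 : p = 1 ∨ 2 ≤ p := by omega
        · obtain ⟨r, hr⟩ := H.odd
          refine nsmul_two_ne_odd hδ q 1 r odd_one ?_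
          rw [← hr, ← he₁, hpq]
        · have := nsmul_le_nsmul_left H.e₁_pos.le hp2
          grind
      · obtain ⟨p, q, hp, -, hle'⟩ := hbound (H.formDeg_zero_one_of_b_ne ha hb)
        have := nsmul_le_nsmul_left H.e₁_pos.le hp
        have := H.e₃_le_of_b_ne hb
        have := H.α_eq_of_b_ne hb
        grind
    · obtain ⟨p, q, hp, -, hle'⟩ := hbound (H.formDeg_zero_one_of_a_ne ha)
      have := nsmul_le_nsmul_left H.e₁_pos.le hp
      have := H.α_eq_of_a_ne ha
      grind

end SUData

theorem omitAlgebra_eq {F : Fin 3 → MvPolynomial (Fin n) k} (hF : Function.Injective F)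
    {i j l : Fin 3} (hij : i ≠ j) (hil : i ≠ l) (hjl : j ≠ l) :
    omitAlgebra F i = Algebra.adjoin k {F j, F l} := by
  rw [omitAlgebra]
  congr 1
  ext x
  constructor
  · rintro ⟨⟨m, rfl⟩, hm⟩
    have hm' : m ≠ i := fun h => hm (h ▸ rfl)
    obtain rfl | rfl : m = j ∨ m = l := by omega
    · exact Or.inl rfl
    · exact Or.inr rfl
  · rintro (rfl | rfl)
    · exact ⟨⟨j, rfl⟩, fun h => hij (hF h).symm⟩
    · exact ⟨⟨l, rfl⟩, fun h => hil (hF h).symm⟩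

/-- Only the entry `l` changes, so its degree drops; the added polynomial must cancel its initial
form. -/
theorem AdmitsElementaryReduction.exists_mem_initialSpace (hF : AlgebraicIndependent k F)
    (h : AdmitsElementaryReduction w F) :
    ∃ i, initialForm w (F i) ∈ initialSpace w (omitAlgebra F i).toSubmodule := by
  classical
  obtain ⟨σ, ⟨l, φ, hφ, hl, hfix⟩, hlt⟩ := h
  choose d hd using fun i => exists_wdeg_eq_coe (w := w) (hF.ne_zero i)
  have hval (i : Fin 3) (hi : i ≠ l) : wdeg w (((aeval F).comp σ) (X i)) = d i := by
    rw [AlgHom.comp_apply, hfix i hi, aeval_X, hd]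
  have hvall : ((aeval F).comp σ) (X l) = F l + aeval F φ := by
    rw [AlgHom.comp_apply, hl, map_add, aeval_X]
  have hmem : aeval F φ ∈ omitAlgebra F l := by
    have h1 : aeval F φ ∈ (Algebra.adjoin k
        {p : MvPolynomial (Fin 3) k | ∃ j, j ≠ l ∧ p = X j}).map (aeval F) := ⟨φ, hφ, rfl⟩
    rw [AlgHom.map_adjoin] at h1
    refine Algebra.adjoin_mono ?_ h1
    rintro _ ⟨_, ⟨j, hj, rfl⟩, rfl⟩
    rw [aeval_X]
    exact ⟨⟨j, rfl⟩, fun h => hj (hF.injective h)⟩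
  have hdrop : wdeg w (F l + aeval F φ) < d l := by
    rw [← Finset.add_sum_erase _ _ (Finset.mem_univ l),
      ← Finset.add_sum_erase (a := l) _ (fun i => wdeg w (F i)) (Finset.mem_univ l), hvall, hd l,
      Finset.sum_congr rfl fun i hi => hval i (Finset.ne_of_mem_erase hi),
      Finset.sum_congr (g := fun i => ((d i : Γ) : WithBot Γ)) rfl fun i _ => hd i] at hlt
    exact lt_of_add_lt_add_right hlt
  have htop : HasTop w (-aeval F φ) (d l) (initialForm w (F l)) := by
    simpa using (hasTop_initialForm (hd l)).sub (HasTop.zero_of_lt hdrop)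
  have hne := initialForm_ne_zero (w := w) (hF.ne_zero l)
  refine ⟨l, Submodule.subset_span ⟨-aeval F φ, neg_mem hmem, ?_, (htop.initialForm_eq hne).symm⟩⟩
  intro h0
  have := htop.wdeg_eq hne
  rw [h0, wdeg_zero] at this
  exact WithBot.bot_ne_coe this

end SU

end ShestakovUmirbaev

theorem proposition8p3 {k : Type*} [Field k] [CharZero k]
    {Γ : Type*} [AddCommGroup Γ] [LinearOrder Γ] [IsOrderedAddMonoid Γ] [AddGroup.FG Γ]
    {n : ℕ} (hn : 3 ≤ n) (w : Fin n → Γ) (hw : ∀ i, 0 < w i)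
    (F G : Fin 3 → MvPolynomial (Fin n) k)
    (hF : AlgebraicIndependent k F) (hG : AlgebraicIndependent k G)
    (hFG : SUCondition w F G) :
    (¬ Approx (initialForm w (F 0)) (initialForm w (F 2) ^ 2) →
      initialForm w (F 0) ∉ initialSpace w (omitAlgebra F 0).toSubmodule) ∧
    initialForm w (F 1) ∉ initialSpace w (omitAlgebra F 1).toSubmodule ∧
    ((F 0, F 1) ≠ (G 0, G 1) →
      initialForm w (F 2) ∉ initialSpace w (omitAlgebra F 2).toSubmodule) ∧
    (AdmitsElementaryReduction w F →
      Approx (initialForm w (F 0)) (initialForm w (F 2) ^ 2) ∨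
        (F 0, F 1) = (G 0, G 1)) := by
  obtain ⟨a, b, c, δ, α, D, e₁, e₃, E, E', H⟩ := hFG.exists_data hw hF hG
  have h0 : omitAlgebra F 0 = Algebra.adjoin k {F 1, F 2} :=
    omitAlgebra_eq hF.injective (by decide) (by decide) (by decide)
  have h1 : omitAlgebra F 1 = Algebra.adjoin k {F 0, F 2} :=
    omitAlgebra_eq hF.injective (by decide) (by decide) (by decide)
  have h2 : omitAlgebra F 2 = Algebra.adjoin k {F 0, F 1} :=
    omitAlgebra_eq hF.injective (by decide) (by decide) (by decide)
  refine ⟨fun h => h0 ▸ H.notMem_initialSpace_zero h, h1 ▸ H.notMem_initialSpace_one,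
    fun h => h2 ▸ H.notMem_initialSpace_two h, fun hred => ?_⟩
  obtain ⟨i, hi⟩ := hred.exists_mem_initialSpace hF
  by_contra! hcon
  obtain rfl | rfl | rfl : i = 0 ∨ i = 1 ∨ i = 2 := by omega
  · exact H.notMem_initialSpace_zero hcon.1 (h0 ▸ hi)
  · exact H.notMem_initialSpace_one (h1 ▸ hi)
  · exact H.notMem_initialSpace_two hcon.2 (h2 ▸ hi)
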